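/- **Proposition 2.4 (generalized Berger formula).** Let $k$ be an algebraically closed field of characteristic $0$, let $A=k[X,Y]$, and let $f\in A$ be irreducible. Let $R=A/(f)$, let $\varphi:A\to R$ be the canonical map, let $K$ be the field of fractions of $R$, and let $\overline R$ be the integral closure of $R$ in $K$. For $h\in A$ put $J_f(h)=h_Xf_Y-h_Yf_X$. Let $J_f\subset A$ be the ideal generated by all $J_f(h)$, $h\in A$, i.e. $J_f=(f_X,f_Y)A$; let $Jac_f=(f)+J_f$ and $\overline J_f=\varphi(J_f)\subset R$. For $u=\varphi(g)/\varphi(h)\in K$ with $g,h\in A$ and $\varphi(h)\ne 0$, let $$J_f(u)=\frac{\varphi(J_f(g))}{\varphi(h)}-\frac{\varphi(g\,J_f(h))}{\varphi(h)^2}\in K,$$ which does not depend on the choice of $g,h$. Let $\mathfrak C=\{u\in R : u\overline R\subset R\}$ be the conductor. Let $\Omega(S,k)$ denote the module of Kähler differentials of a $k$-algebra $S$, and let $l$ denote the length of a module (over $A$ for $A/Jac_f$, over $R$ otherwise). Then: 1. The $\overline R$-submodule of $K$ generated by all $J_f(u)$, $u\in\overline R$, is equal to $\mathfrak C$. 2.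 There is an element $u\in K$ with $du\neq 0$ in $\Omega(K,k)$, and for all such $u$ one has $J_f(u)\neq0$ and the element $\omega=du/J_f(u)\in\Omega(K,k)$ is the same (the fundamental differential of $f$). The natural map $\Omega(\overline R,k)\to\Omega(K,k)$ is injective, and its image is $\mathfrak C\,\omega=\{c\,\omega : c\in\mathfrak C\}$. 3. $\overline J_f\subset\mathfrak C$, and $$l(A/Jac_f)=l(R/\overline J_f)=l(R/\mathfrak C)+l(\mathfrak C/\overline J_f)=l(\overline R/R)+l\bigl(\Omega(\overline R,k)/\Omega(R,k)\bigr),$$ where all lengths are finite and $\Omega(\overline R,k)/\Omega(R,k)$ denotes the cokernel of the natural map $\Omega(R,k)\to\Omega(\overline R,k)$. -/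

import Mathlib

namespace PlaneCurve

open MvPolynomial KaehlerDifferential

section PolynomialRing

variable {k : Type*} [Field k]

/-- The coordinate ring `R = A / (f)` of the plane curve `f`, where `A = k[X, Y]`. -/
def CoordRing (f : MvPolynomial (Fin 2) k) : Type _ :=
  MvPolynomial (Fin 2) k ⧸ Ideal.span {f}

noncomputable instance (f : MvPolynomial (Fin 2) k) : CommRing (CoordRing f) :=
  inferInstanceAs (CommRing (MvPolynomial (Fin 2) k ⧸ Ideal.span {f}))

noncomputable instance (f : MvPolynomial (Fin 2) k) : Algebra k (CoordRing f) :=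
  inferInstanceAs (Algebra k (MvPolynomial (Fin 2) k ⧸ Ideal.span {f}))

/-- The canonical homomorphism `φ_f : A → R`. -/
noncomputable def toCoordRing (f : MvPolynomial (Fin 2) k) :
    MvPolynomial (Fin 2) k →+* CoordRing f :=
  Ideal.Quotient.mk (Ideal.span {f})

/-- The jacobian `J_f(h) = h_X f_Y - h_Y f_X` of a polynomial `h`. -/
noncomputable def jacobian (f h : MvPolynomial (Fin 2) k) : MvPolynomial (Fin 2) k :=
  pderiv 0 h * pderiv 1 f - pderiv 1 h * pderiv 0 f

/-- The ideal `J_f` of `A` generated by all the jacobians `J_f(h)`, `h ∈ A`. -/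
noncomputable def jacobianIdeal (f : MvPolynomial (Fin 2) k) : Ideal (MvPolynomial (Fin 2) k) :=
  Ideal.span (Set.range (jacobian f))

/-- The ideal `Jac_f = (f, J_f) A`. -/
noncomputable def extJacobianIdeal (f : MvPolynomial (Fin 2) k) :
    Ideal (MvPolynomial (Fin 2) k) :=
  Ideal.span {f} ⊔ jacobianIdeal f

/-- The ideal `φ_f(J_f)` of `R`, written `J̄_f`. -/
noncomputable def jacobianIdealBar (f : MvPolynomial (Fin 2) k) : Ideal (CoordRing f) :=
  (jacobianIdeal f).map (toCoordRing f)

theorem jacobianIdeal_eq (f : MvPolynomial (Fin 2) k) :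
    jacobianIdeal f = Ideal.span {pderiv 0 f, pderiv 1 f} := by
  apply le_antisymm
  · refine Ideal.span_le.2 ?_
    rintro _ ⟨h, rfl⟩
    exact Ideal.sub_mem _
      (Ideal.mul_mem_left _ _ (Ideal.subset_span (by simp)))
      (Ideal.mul_mem_left _ _ (Ideal.subset_span (by simp)))
  · refine Ideal.span_le.2 ?_
    rintro g (rfl | rfl)
    · have h : jacobian f (-X 1) = pderiv 0 f := by
        simp [jacobian, pderiv_X]
      exact h ▸ Ideal.subset_span ⟨_, rfl⟩
    · have h : jacobian f (X 0) = pderiv 1 f := by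
        simp [jacobian, pderiv_X]
      exact h ▸ Ideal.subset_span ⟨_, rfl⟩

theorem jacobian_mul (f g h : MvPolynomial (Fin 2) k) :
    jacobian f (g * h) = g * jacobian f h + h * jacobian f g := by
  simp only [jacobian, Derivation.leibniz, smul_eq_mul]
  ring

theorem jacobian_sub (f g h : MvPolynomial (Fin 2) k) :
    jacobian f (g - h) = jacobian f g - jacobian f h := by
  simp only [jacobian, map_sub]
  ring

theorem jacobian_self (f : MvPolynomial (Fin 2) k) : jacobian f f = 0 := by
  simp only [jacobian]
  ring

end PolynomialRing

section FunctionField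

variable {k : Type*} [Field k] (f : MvPolynomial (Fin 2) k)
variable (K : Type*) [Field K] [Algebra (CoordRing f) K]

/-- The value `h(x, y) ∈ K` of the polynomial `h` at the generic point of the curve,
where `K` is the function field. -/
noncomputable def value (h : MvPolynomial (Fin 2) k) : K :=
  algebraMap (CoordRing f) K (toCoordRing f h)

variable [IsFractionRing (CoordRing f) K]

variable {K} in
theorem exists_fraction (u : K) :
    ∃ p : MvPolynomial (Fin 2) k × MvPolynomial (Fin 2) k,
      value f K p.2 ≠ 0 ∧ u = value f K p.1 / value f K p.2 := by
  have : Nontrivial (CoordRing f) := (algebraMap (CoordRing f) K).domain_nontrivial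
  obtain ⟨a, b, hb, rfl⟩ := IsFractionRing.div_surjective (A := CoordRing f) u
  obtain ⟨g, rfl⟩ := Ideal.Quotient.mk_surjective a
  obtain ⟨h, rfl⟩ := Ideal.Quotient.mk_surjective b
  exact ⟨(g, h), (IsLocalization.map_units K
    (⟨_, hb⟩ : nonZeroDivisors (CoordRing f))).ne_zero, rfl⟩

variable {K} in
/-- The jacobian `J_f(u)` of an element `u = g(x, y) / h(x, y)` of the function field, given by
the quotient rule; `funJacobian_eq` below says that the choice of `g` and `h` is immaterial. -/
noncomputable def funJacobian (u : K) : K :=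
  let g := (exists_fraction f u).choose.1
  let h := (exists_fraction f u).choose.2
  value f K (jacobian f g) / value f K h - value f K (g * jacobian f h) / value f K h ^ 2

theorem funJacobian_eq (g h : MvPolynomial (Fin 2) k) (hh : value f K h ≠ 0) :
    funJacobian f (value f K g / value f K h) =
      value f K (jacobian f g) / value f K h -
        value f K (g * jacobian f h) / value f K h ^ 2 := by
  have hmul : ∀ a b, value f K (a * b) = value f K a * value f K b := by simp [value]
  have hadd : ∀ a b, value f K (a + b) = value f K a + value f K b := by simp [value]
  have hsub : ∀ a b, value f K (a - b) = value f K a - value f K b := by simp [value]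
  have hf : value f K f = 0 := by
    have : toCoordRing f f = 0 :=
      Ideal.Quotient.eq_zero_iff_mem.2 (Ideal.mem_span_singleton_self f)
    rw [value, this, map_zero]
  have hzero : ∀ a, value f K a = 0 → value f K (jacobian f a) = 0 := by
    intro a ha
    have h0 : toCoordRing f a = 0 := by
      apply IsFractionRing.injective (CoordRing f) K
      rw [map_zero]
      exact ha
    obtain ⟨c, rfl⟩ := Ideal.mem_span_singleton.1 (Ideal.Quotient.eq_zero_iff_mem.1 h0)
    rw [jacobian_mul, jacobian_self, hadd, hmul, hmul, hf]
    simp [value]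
  obtain ⟨h1, h2⟩ := (exists_fraction f (value f K g / value f K h)).choose_spec
  simp only [funJacobian]
  set g' := (exists_fraction f (value f K g / value f K h)).choose.1
  set h' := (exists_fraction f (value f K g / value f K h)).choose.2
  have h3 : value f K g * value f K h' = value f K g' * value f K h :=
    (div_eq_div_iff hh h1).1 h2
  have h4 : value f K (g * h' - g' * h) = 0 := by rw [hsub, hmul, hmul, h3, sub_self]
  have h5 := hzero _ h4
  rw [jacobian_sub, jacobian_mul, jacobian_mul, hsub, hadd, hadd, hmul, hmul, hmul, hmul] at h5
  rw [hmul, hmul]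
  have h6 : value f K g = value f K g' * value f K h / value f K h' := by
    field_simp
    exact h3
  rw [h6] at h5 ⊢
  field_simp at h5 ⊢
  linear_combination -h5

/-- The integral closure `R̄` of `R` in the function field. -/
abbrev Normalization : Type _ := integralClosure (CoordRing f) K

/-- The conductor `𝔠 = {u ∈ R | u R̄ ⊆ R}`, as an ideal of `R`. -/
def conductorIdeal : Ideal (CoordRing f) where
  carrier := {u | ∀ b : Normalization f K, ∃ c : CoordRing f,
    algebraMap (CoordRing f) (Normalization f K) c = u • b}
  add_mem' := by
    intro u v hu hv b
    obtain ⟨c, hc⟩ := hu b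
    obtain ⟨d, hd⟩ := hv b
    exact ⟨c + d, by rw [map_add, hc, hd, add_smul]⟩
  zero_mem' := fun b => ⟨0, by rw [map_zero, zero_smul]⟩
  smul_mem' := by
    intro a u hu b
    obtain ⟨c, hc⟩ := hu b
    exact ⟨a * c, by rw [map_mul, hc, smul_assoc, Algebra.smul_def a]⟩

/-- The `R̄`-submodule `J*` of the function field generated by the jacobians `J_f(u)`,
`u ∈ R̄`. -/
noncomputable def normJacobianIdeal : Submodule (Normalization f K) K :=
  Submodule.span (Normalization f K)
    (Set.range fun u : Normalization f K => funJacobian f (u : K))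

variable [Algebra k K]

variable {K} in
/-- `ω` is the fundamental differential of `f`: the common value of `dh / J_f(h)` for all `h` in
the function field with `dh ≠ 0` (there is such an `h`, and `J_f(h) ≠ 0` for each of them). -/
def IsFundamentalDifferential (ω : Ω[K⁄k]) : Prop :=
  (∃ h : K, D k K h ≠ 0) ∧
    ∀ h : K, D k K h ≠ 0 → funJacobian f h ≠ 0 ∧ ω = (funJacobian f h)⁻¹ • D k K h

variable [IsScalarTower k (CoordRing f) K]

/-- The image of `Ω(R, k)` in `Ω(R̄, k)` under the natural map, an `R`-submodule. -/
noncomputable def differentialsImage :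
    Submodule (CoordRing f) (Ω[Normalization f K⁄k]) :=
  LinearMap.range (KaehlerDifferential.map k k (CoordRing f) (Normalization f K))

end FunctionField

end PlaneCurve

/-! For a general `c`, the function `x' = X + cY` makes `R` finite over the polynomial ring `k[x']`,
and `R = k[x'][y]` with `y` the class of `Y`. Up to a unit, `f` becomes the minimal polynomial `F`
of `y`. The jacobian `J_f` extends to a `k`-derivation of `K`, and `J_f(x')` is `F'(y)` times a unit
of `R`.

Part 1 compares two identities over the Dedekind domain `R̄`. One is Dedekind's formula: conductor
times different of `R̄` over `k[x']` is `(F'(y))`. The other,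
`Derivation.span_range_mul_differentIdeal`, says that for any derivation `d` the module spanned by
`d(R̄)`, times the same different, is generated by `d x'`. It is checked at each closed point, where
`d x'` is a unit times `t ^ (e - 1) dt` for a uniformizer `t` and ramification index `e`, while
characteristic zero makes the different exactly the `(e - 1)`-st power. Cancelling the different for
`d = J_f` gives the conductor.

For part 2, `du ↦ J_f(u)` is an isomorphism `Ω(K, k) → K`, and `ω` is the preimage of `1`. The
differentials of `R̄` are locally generated by one `dt`, hence embed in `Ω(K, k)`, and part 1
identifies their image.

For part 3, Euler's formula says that the trace dual of `R` is `F'(y)⁻¹ R`, so that the dual of `R̄`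
is `F'(y)⁻¹ 𝔠`. Duality of lattices preserves colength, hence `l(R/𝔠) = l(R̄/R)`
(`Algebra.length_quotient_conductor`). Finally `J_f` carries `Ω(R̄, k)` onto `𝔠` and the image of
`Ω(R, k)` onto `J̄_f`, which matches the remaining quotients. -/

/-! ### Length as dimension over the ground field. -/

section Length

/-- Over an algebraically closed field, the length of a module over an algebra of finite type
is its dimension. -/
theorem Module.length_eq_length_of_isAlgClosed (k : Type*) {S M : Type*} [Field k] [IsAlgClosed k]
    [CommRing S] [Algebra k S] [Algebra.FiniteType k S] [AddCommGroup M] [Module k M] [Module S M]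
    [IsScalarTower k S M] : Module.length S M = Module.length k M := by
  have hle : Module.length S M ≤ Module.length k M := by
    rw [← WithBot.coe_le_coe, Module.coe_length, Module.coe_length]
    exact Order.krullDim_le_of_orderEmbedding (Submodule.restrictScalarsEmbedding k S M)
  by_cases h : Module.length S M = ⊤
  · rw [h, top_le_iff] at hle
    rw [h, hle]
  rw [← ne_eq, Module.length_ne_top_iff] at h
  clear hle
  rename_i iM iS iT
  -- The `k`-structure is generalized so that the induction hypothesis applies to the submodule with
  -- its own `k`-structure.
  revert iM iT
  induction h with
  | of_subsingleton => intros; simp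
  | @of_simple_quotient M _ _ N _ _ ih =>
    intro _ _
    rw [Module.length_eq_add_of_exact N.subtype N.mkQ N.subtype_injective N.mkQ_surjective
      (LinearMap.exact_subtype_mkQ N), Module.length_eq_add_of_exact
      (N.subtype.restrictScalars k) (N.mkQ.restrictScalars k) N.subtype_injective
      N.mkQ_surjective (LinearMap.exact_subtype_mkQ N), ih]
    congr 1
    -- A simple subquotient is a residue field of `S`, which is `k` by the Nullstellensatz.
    obtain ⟨m, hm, ⟨e⟩⟩ := isSimpleModule_iff_quot_maximal.1 (‹IsSimpleModule S (M ⧸ N)›)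
    rw [Module.length_eq_one, (e.restrictScalars k).length_eq]
    let := Ideal.Quotient.field m
    have : Module.Finite k (S ⧸ m) := finite_of_finite_type_of_isJacobsonRing k (S ⧸ m)
    rw [Module.length_eq_of_surjective (R := S ⧸ m)
      (IsAlgClosed.algebraMap_bijective_of_isIntegral (k := k) (K := S ⧸ m)).2]
    exact (Module.length_eq_one (S ⧸ m) (S ⧸ m)).symm

end Length

/-! ### Lattices over a principal ideal domain and their duals. -/

section Lattice

variable {A K L : Type*} [CommRing A] [Field K] [AddCommGroup L] [Algebra A K] [Module A L]
  [Module K L] [IsScalarTower A K L]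

/-- In the coordinates given by `c` the smaller span is the product of the ideals `(a i)`. The lemma
serves twice, for a Smith basis and for the dual basis. -/
theorem Submodule.nonempty_quotient_span_smul_equiv {ι : Type*} [Finite ι] {c : ι → L}
    (hc : LinearIndependent A c) (a : ι → A) :
    Nonempty ((span A (Set.range c) ⧸
      (span A (Set.range fun i => a i • c i)).submoduleOf (span A (Set.range c))) ≃ₗ[A]
      ∀ i, A ⧸ Ideal.span {a i}) := by
  classical
  have := Fintype.ofFinite ι
  let b := Module.Basis.span hc
  let N := (span A (Set.range fun i => a i • c i)).submoduleOf (span A (Set.range c))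
  let N' : Submodule A (ι → A) := Submodule.pi Set.univ fun i => Ideal.span {a i}
  have hsum : ∀ x : ι → A, ((b.equivFun.symm x : span A (Set.range c)) : L) = ∑ i, x i • c i := by
    intro x
    simp [Module.Basis.equivFun_symm_apply, b, Module.Basis.span_apply]
  have hN : N'.map (b.equivFun.symm : (ι → A) →ₗ[A] span A (Set.range c)) = N := by
    ext x
    constructor
    · rintro ⟨y, hy, rfl⟩
      change ((b.equivFun.symm y : span A (Set.range c)) : L) ∈ span A (Set.range fun i => a i • c i)
      rw [hsum]
      refine Submodule.sum_mem _ fun i _ => ?_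
      obtain ⟨d, hd⟩ := Ideal.mem_span_singleton'.1 (hy i trivial)
      rw [← hd, mul_smul]
      exact Submodule.smul_mem _ _ (Submodule.subset_span ⟨i, rfl⟩)
    · intro hx
      change (x : L) ∈ span A (Set.range fun i => a i • c i) at hx
      obtain ⟨d, hd⟩ := (Submodule.mem_span_range_iff_exists_fun A).1 hx
      refine ⟨fun i => d i * a i, fun i _ => Ideal.mem_span_singleton'.2 ⟨d i, rfl⟩, ?_⟩
      ext
      change ((b.equivFun.symm _ : span A (Set.range c)) : L) = _
      rw [hsum, ← hd]
      simp [mul_smul]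
  exact ⟨(Submodule.Quotient.equiv N' N b.equivFun.symm hN).symm.trans
    (Submodule.quotientPi fun i => (Ideal.span {a i} : Submodule A A))⟩

theorem Submodule.span_range_basis {ι : Type*} {P : Submodule A L} (b : Module.Basis ι A P) :
    span A (Set.range fun i => (b i : L)) = P := by
  have := congrArg (Submodule.map P.subtype) b.span_eq
  rwa [Submodule.map_span, ← Set.range_comp, Submodule.map_top, Submodule.range_subtype] at this

theorem Submodule.span_range_basis_fractionRing {ι : Type*} {P : Submodule A L}
    (b : Module.Basis ι A P) (hP : span K (P : Set L) = ⊤) :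
    span K (Set.range fun i => (b i : L)) = ⊤ := by
  rw [← hP]
  conv_rhs => rw [← span_range_basis b]
  exact (Submodule.span_span_of_tower A K _).symm

variable [IsFractionRing A K]

theorem Submodule.linearIndependent_basis {ι : Type*} {P : Submodule A L}
    (b : Module.Basis ι A P) : LinearIndependent K fun i => (b i : L) := by
  rw [← LinearIndependent.iff_fractionRing (R := A)]
  exact b.linearIndependent.map' P.subtype P.ker_subtype

/-- The basis over the fraction field obtained from a basis of a lattice. -/
noncomputable def Submodule.basisFractionRing {ι : Type*} {P : Submodule A L}
    (b : Module.Basis ι A P) (hP : span K (P : Set L) = ⊤) : Module.Basis ι K L :=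
  Module.Basis.mk (linearIndependent_basis b) (span_range_basis_fractionRing b hP).ge

variable [IsDomain A] [IsPrincipalIdealRing A]

theorem Submodule.finrank_eq_of_span_eq_top {P : Submodule A L} (hfg : P.FG)
    (hP : span K (P : Set L) = ⊤) : Module.finrank A P = Module.finrank K L := by
  have : Module.IsTorsionFree A L := Module.IsTorsionFree.trans_faithfulSMul A K L
  have : Module.Finite A P := Module.Finite.iff_fg.2 hfg
  let b := Module.Free.chooseBasis A P
  rw [Module.finrank_eq_card_basis b, Module.finrank_eq_card_basis (basisFractionRing b hP)]

/-- Passing to dual lattices preserves the length of a quotient. -/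
theorem LinearMap.BilinForm.length_quotient_dualSubmodule [FiniteDimensional K L]
    {B : LinearMap.BilinForm K L}
    (hB : B.Nondegenerate) {M N : Submodule A L} (hNM : N ≤ M) (hM : M.FG)
    (hN : Submodule.span K (N : Set L) = ⊤) :
    Module.length A (B.dualSubmodule N ⧸ (B.dualSubmodule M).submoduleOf (B.dualSubmodule N)) =
      Module.length A (M ⧸ N.submoduleOf M) := by
  classical
  have : Module.IsTorsionFree A L := Module.IsTorsionFree.trans_faithfulSMul A K L
  have : Module.Finite A M := Module.Finite.iff_fg.2 hM
  have hM' : Submodule.span K (M : Set L) = ⊤ :=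
    top_le_iff.1 (hN ▸ Submodule.span_mono hNM)
  have hNfg : N.FG := by
    have := (IsNoetherian.noetherian (N.submoduleOf M)).map M.subtype
    rwa [Submodule.submoduleOf, Submodule.map_comap_subtype, inf_eq_right.2 hNM] at this
  let e : N.submoduleOf M ≃ₗ[A] N := Submodule.submoduleOfEquivOfLe hNM
  obtain ⟨b, a, bN, hab⟩ := Submodule.exists_smith_normal_form_of_rank_eq
    (Module.Free.chooseBasis A M) (N := N.submoduleOf M) (by
      rw [e.finrank_eq, Submodule.finrank_eq_of_span_eq_top hNfg hN,
        Submodule.finrank_eq_of_span_eq_top hM hM'])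
  let b₁ := Submodule.basisFractionRing b hM'
  let b₂ := Submodule.basisFractionRing (bN.map e) hN
  have hb₁ : ⇑b₁ = fun i => (b i : L) := Module.Basis.coe_mk _ _
  have hb₂ : ⇑b₂ = fun i => a i • (b i : L) := by
    refine (Module.Basis.coe_mk _ _).trans ?_
    ext i
    exact congrArg Subtype.val (hab i)
  have hMspan : Submodule.span A (Set.range b₁) = M := hb₁ ▸ Submodule.span_range_basis b
  have hNspan : Submodule.span A (Set.range b₂) = N := by
    have h := Submodule.span_range_basis (bN.map e)
    exact (congrArg (fun f => Submodule.span A (Set.range f)) (Module.Basis.coe_mk _ _)).trans h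
  -- Dualizing exchanges the two bases and keeps the elementary divisors `a i`, so both quotients
  -- are the same product of cyclic modules.
  have hdual : ⇑(B.dualBasis hB b₁) = fun i => a i • B.dualBasis hB b₂ i := by
    ext i
    refine (B.dualBasis hB b₂).ext_elem fun j => ?_
    have h : b₂ j = a j • b₁ j := by rw [hb₁, hb₂]
    rw [LinearMap.BilinForm.dualBasis_repr_apply, ← algebraMap_smul K (a i), map_smul, h,
      ← algebraMap_smul K (a j), map_smul, LinearMap.BilinForm.apply_dualBasis_left]
    by_cases hij : j = i
    · subst hij; simp [Algebra.smul_def]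
    · simp [hij]
  obtain ⟨e₁⟩ := Submodule.nonempty_quotient_span_smul_equiv
    ((LinearIndependent.iff_fractionRing A K).2 b₁.linearIndependent) a
  obtain ⟨e₂⟩ := Submodule.nonempty_quotient_span_smul_equiv
    ((LinearIndependent.iff_fractionRing A K).2 (B.dualBasis hB b₂).linearIndependent) a
  rw [← hdual, ← LinearMap.BilinForm.dualSubmodule_span_of_basis,
    ← LinearMap.BilinForm.dualSubmodule_span_of_basis, hMspan, hNspan] at e₂
  have h : (fun i => a i • b₁ i) = b₂ := by rw [hb₁, hb₂]
  rw [h, hMspan, hNspan] at e₁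
  rw [e₁.length_eq, e₂.length_eq]

end Lattice

/-! ### Differentials and uniformizers on a regular affine curve. -/

section Regular

open KaehlerDifferential

section Nakayama

theorem KaehlerDifferential.D_mem_smul_top_of_mem_sq (k : Type*) {B : Type*} [CommRing k]
    [CommRing B] [Algebra k B] {P : Ideal B} {z : B} (hz : z ∈ P ^ 2) :
    D k B z ∈ P • (⊤ : Submodule B Ω[B⁄k]) := by
  rw [pow_two] at hz
  induction hz using Submodule.mul_induction_on' with
  | mem_mul_mem a ha b hb =>
    rw [Derivation.leibniz]
    exact add_mem (Submodule.smul_mem_smul ha trivial) (Submodule.smul_mem_smul hb trivial)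
  | add x _ y _ hx hy =>
    rw [map_add]
    exact add_mem hx hy

variable (k : Type*) {B : Type*} [Field k] [IsAlgClosed k] [CommRing B] [Algebra k B]
  [Algebra.FiniteType k B]

/-- Nullstellensatz: the residue field at `P` is finite over `k`, hence equal to `k`. -/
theorem Ideal.IsMaximal.exists_sub_algebraMap_mem {P : Ideal B} (hP : P.IsMaximal) (u : B) :
    ∃ c : k, u - algebraMap k B c ∈ P := by
  let := Ideal.Quotient.field P
  have : Module.Finite k (B ⧸ P) := finite_of_finite_type_of_isJacobsonRing k (B ⧸ P)
  obtain ⟨c, hc⟩ := (IsAlgClosed.algebraMap_bijective_of_isIntegral (k := k) (K := B ⧸ P)).2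
    (Ideal.Quotient.mk P u)
  exact ⟨c, Ideal.Quotient.eq.1 hc.symm⟩

variable [IsDedekindDomain B]

/-- Near a closed point of a regular curve, the differentials are generated by the differential
of a uniformizer. -/
theorem KaehlerDifferential.exists_notMem_forall_smul_mem_span_D {P : Ideal B} (hP : P.IsMaximal)
    {t : B} (ht : t ∈ P) (ht' : t ∉ P ^ 2) :
    ∃ s ∉ P, ∀ η : Ω[B⁄k], s • η ∈ Submodule.span B {D k B t} := by
  have hPbot : P ≠ ⊥ := by
    rintro rfl
    exact ht' (by simp [(Ideal.mem_bot).1 ht])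
  let N := Submodule.span B {D k B t}
  -- Nakayama applied to `Ω / (dt)`: modulo constants every `u` is `d t + e` with `e ∈ P ^ 2`, so
  -- `du` lies in `(dt) + P Ω`.
  have htop : (⊤ : Submodule B (Ω[B⁄k] ⧸ N)) ≤ P • ⊤ := by
    have h1 : (⊤ : Submodule B (Ω[B⁄k] ⧸ N)) =
        (Submodule.span B (Set.range (D k B))).map N.mkQ := by
      rw [KaehlerDifferential.span_range_derivation, Submodule.map_top, Submodule.range_mkQ]
    have h2 : (P • ⊤ : Submodule B Ω[B⁄k]).map N.mkQ ≤ P • ⊤ := by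
      rw [Submodule.map_smul'']
      exact Submodule.smul_mono le_rfl le_top
    refine h1.le.trans ?_
    rw [Submodule.map_span, Submodule.span_le]
    rintro _ ⟨_, ⟨u, rfl⟩, rfl⟩
    obtain ⟨c, hc⟩ := hP.exists_sub_algebraMap_mem k u
    obtain ⟨d, e, he, hde⟩ := Ideal.exists_mul_add_mem_pow_succ (i := 1) hPbot t _
      (by simpa using ht) ht' (by simpa using hc)
    have hu : D k B u = d • D k B t + (t • D k B d + D k B e) := by
      have : D k B u = D k B (u - algebraMap k B c) := by simp
      rw [this, ← hde, map_add, Derivation.leibniz]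
      abel
    have : N.mkQ (D k B u) = N.mkQ (t • D k B d + D k B e) := by
      rw [hu, map_add, add_eq_right]
      exact (Submodule.Quotient.mk_eq_zero _).2
        (Submodule.smul_mem _ _ (Submodule.mem_span_singleton_self _))
    rw [SetLike.mem_coe, this]
    exact h2 (Submodule.mem_map_of_mem (add_mem (Submodule.smul_mem_smul ht trivial)
      (D_mem_smul_top_of_mem_sq k he)))
  obtain ⟨s, hs, hs'⟩ := Submodule.exists_sub_one_mem_and_smul_eq_zero_of_fg_of_le_smul P
    (⊤ : Submodule B (Ω[B⁄k] ⧸ N)) Module.Finite.fg_top htop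
  refine ⟨s, fun h => hP.ne_top ((Ideal.eq_top_iff_one P).2 ?_), fun η => ?_⟩
  · simpa using sub_mem h hs
  · exact (Submodule.Quotient.mk_eq_zero N).1 (hs' (N.mkQ η) trivial)

end Nakayama

theorem Ideal.exists_notMem_mul_pow_mem {B : Type*} [CommRing B] [IsDedekindDomain B] {P : Ideal B}
    {t : B} (ht : t ∈ P) {n : ℕ} {I : Ideal B} (hI : P ^ n ∣ I)
    (hI' : ¬ P ^ (n + 1) ∣ I) : ∃ s ∉ P, s * t ^ n ∈ I := by
  obtain ⟨J, rfl⟩ := hI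
  have hJ : ¬ J ≤ P := fun h => hI' <| by
    rw [pow_succ]
    exact mul_dvd_mul_left _ (Ideal.dvd_iff_le.2 h)
  obtain ⟨s, hsJ, hsP⟩ := Set.not_subset.1 hJ
  exact ⟨s, hsP, by rw [mul_comm s]; exact Ideal.mul_mem_mul (Ideal.pow_mem_pow ht n) hsJ⟩

theorem Ideal.IsMaximal.exists_mem_notMem_sq {B : Type*} [CommRing B] [IsDedekindDomain B]
    {P : Ideal B} (hP : P.IsMaximal) (hPbot : P ≠ ⊥) :
    ∃ t ∈ P, t ∉ P ^ 2 := by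
  have := Ideal.pow_right_strictAnti P hPbot hP.ne_top (show 1 < 2 by simp)
  obtain ⟨t, h1, h2⟩ := Set.exists_of_ssubset this
  exact ⟨t, by simpa using h1, h2⟩

section Uniformizer

variable {B : Type*} [CommRing B] [IsDedekindDomain B] {P : Ideal B} (hP : P.IsPrime)
  {t : B} (ht : t ∈ P) (ht' : t ∉ P ^ 2)

include hP ht ht'

/-- This says without localizing that `t` generates `P` locally: `(t) = P I` with `I ⊄ P`, and the
`n`-th power of an element of `I` outside `P` carries `P ^ n` into `(t ^ n)`. -/
theorem Ideal.IsPrime.exists_mul_eq_mul_pow_of_mem_pow {n : ℕ} {z : B} (hz : z ∈ P ^ n) :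
    ∃ s ∉ P, ∃ w, s * z = w * t ^ n := by
  obtain ⟨I, hI⟩ := Ideal.dvd_span_singleton.2 ht
  have hIP : ¬ I ≤ P := fun h => ht' <| by
    rw [← Ideal.span_singleton_le_iff_mem, hI, pow_two]
    exact Ideal.mul_mono_right h
  obtain ⟨s, hsI, hsP⟩ := Set.not_subset.1 hIP
  refine ⟨s ^ n, fun h => hsP (hP.mem_of_pow_mem n h), ?_⟩
  have : s ^ n * z ∈ Ideal.span {t ^ n} := by
    rw [← Ideal.span_singleton_pow, hI, mul_pow, mul_comm (s ^ n)]
    exact Ideal.mul_mem_mul hz (Ideal.pow_mem_pow hsI n)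
  obtain ⟨w, hw⟩ := Ideal.mem_span_singleton'.1 this
  exact ⟨w, hw.symm⟩

theorem Ideal.IsPrime.exists_mul_eq_mul_pow {n : ℕ} {z : B} (hz : z ∈ P ^ n)
    (hz' : z ∉ P ^ (n + 1)) : ∃ s ∉ P, ∃ w ∉ P, s * z = w * t ^ n := by
  obtain ⟨s, hs, w, hw⟩ := hP.exists_mul_eq_mul_pow_of_mem_pow ht ht' hz
  refine ⟨s, hs, w, fun h => ?_, hw⟩
  have : s * z ∈ P ^ (n + 1) := by
    rw [hw, pow_succ']
    exact Ideal.mul_mem_mul h (Ideal.pow_mem_pow ht n)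
  exact (hP.mul_mem_pow P this).elim hs hz'

end Uniformizer

/-- The ideal of all `s` with `s • x ∈ N` lies in no maximal ideal. This replaces localization in
the arguments at closed points. -/
theorem Submodule.mem_of_forall_isMaximal {R M : Type*} [CommRing R] [AddCommGroup M] [Module R M]
    {N : Submodule R M} {x : M} (h : ∀ P : Ideal R, P.IsMaximal → ∃ s ∉ P, s • x ∈ N) :
    x ∈ N := by
  by_contra hx'
  have hne : N.comap (LinearMap.toSpanSingleton R M x) ≠ ⊤ := fun h' => hx' <| by
    have : (1 : R) ∈ N.comap (LinearMap.toSpanSingleton R M x) := h' ▸ trivial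
    simpa using this
  obtain ⟨P, hP, hle⟩ := Ideal.exists_le_maximal _ hne
  obtain ⟨s, hs, hsx⟩ := h P hP
  exact hs (hle (by simpa using hsx))

section Injective

variable (k : Type*) {B K : Type*} [Field k] [IsAlgClosed k] [CommRing B] [Algebra k B]
  [Algebra.FiniteType k B] [IsDedekindDomain B] [Field K] [Algebra B K] [IsFractionRing B K]
  [Algebra k K] [IsScalarTower k B K]

/-- The differentials of a regular affine curve have no torsion. -/
theorem KaehlerDifferential.map_fractionField_injective (hB : ¬ IsField B)
    (hK : Nontrivial Ω[K⁄k]) : Function.Injective (KaehlerDifferential.map k k B K) := by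
  rw [← LinearMap.ker_eq_bot, eq_bot_iff]
  intro η hη
  refine Submodule.mem_of_forall_isMaximal fun P hP => ?_
  obtain ⟨t, ht, ht'⟩ := hP.exists_mem_notMem_sq (Ring.ne_bot_of_isMaximal_of_not_isField hP hB)
  obtain ⟨s, hs, hst⟩ := exists_notMem_forall_smul_mem_span_D k hP ht ht'
  have hs0 : algebraMap B K s ≠ 0 := by
    rw [ne_eq, FaithfulSMul.algebraMap_eq_zero_iff]
    rintro rfl
    exact hs (zero_mem _)
  -- If `dt` vanished in `Ω(K, k)`, so would every differential, since `dt` generates locally and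
  -- the quotient rule passes to fractions.
  have hdt : D k K (algebraMap B K t) ≠ 0 := by
    intro h0
    have hB0 : ∀ b : B, D k K (algebraMap B K b) = 0 := by
      intro b
      obtain ⟨c, hc⟩ := Submodule.mem_span_singleton.1 (hst (D k B b))
      have := congrArg (KaehlerDifferential.map k k B K) hc
      rw [map_smul, map_smul, map_D, map_D, h0, smul_zero, ← algebraMap_smul K s] at this
      exact (smul_eq_zero_iff_right hs0).1 this.symm
    have hK0 : ∀ x : K, D k K x = 0 := by
      intro x
      obtain ⟨a, b, hb, rfl⟩ := IsFractionRing.div_surjective (A := B) x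
      rw [Derivation.leibniz_div, hB0, hB0]
      simp
    have : (⊤ : Submodule K Ω[K⁄k]) = ⊥ := by
      rw [← span_range_derivation, Submodule.span_eq_bot]
      rintro _ ⟨x, rfl⟩
      exact hK0 x
    exact bot_ne_top this.symm
  refine ⟨s, hs, ?_⟩
  obtain ⟨b, hb⟩ := Submodule.mem_span_singleton.1 (hst η)
  have := congrArg (KaehlerDifferential.map k k B K) hb
  rw [map_smul, map_smul, map_D, LinearMap.mem_ker.1 hη, smul_zero, ← algebraMap_smul K b] at this
  have hb0 := (smul_eq_zero_iff_left hdt).1 this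
  rw [FaithfulSMul.algebraMap_eq_zero_iff] at hb0
  rw [← hb, hb0, zero_smul]
  exact zero_mem _

end Injective

end Regular

/-! ### The different in tame ramification. -/

section TraceOfIdempotent

open KaehlerDifferential Polynomial

/-- Multiplication by `z` is a projection; its trace is its rank, which is nonzero in characteristic
zero. -/
theorem Algebra.trace_ne_zero_of_isIdempotentElem {F S : Type*} [CommRing F] [CharZero F]
    [CommRing S] [Algebra F S] [Module.Finite F S] (hF : IsField F) {z : S}
    (hz : IsIdempotentElem z) (hz0 : z ≠ 0) : Algebra.trace F S z ≠ 0 := by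
  let := hF.toField
  have h : IsIdempotentElem (Algebra.lmul F S z) := hz.map (Algebra.lmul F S)
  rw [Algebra.trace_apply, ne_eq, LinearMap.IsIdempotentElem.trace_eq_zero_iff h]
  intro h0
  have := LinearMap.congr_fun h0 1
  exact hz0 (by simpa using this)

section Tame

attribute [local instance] FractionRing.liftAlgebra FractionRing.isScalarTower_liftAlgebra

variable {A B : Type*} [CommRing A] [IsDedekindDomain A] [CommRing B] [IsDedekindDomain B]
  [Algebra A B] [Module.IsTorsionFree A B] [Module.Finite A B]
  [Algebra.IsSeparable (FractionRing A) (FractionRing B)]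

/-- In residue characteristic zero, the exponent of the different is less than the ramification
index. -/
theorem not_pow_dvd_differentIdeal_of_charZero {p : Ideal A} [hp : p.IsMaximal]
    [CharZero (A ⧸ p)] {P Q : Ideal B} [hP : P.IsMaximal] {e : ℕ} (he : e ≠ 0)
    (hPQ : P ^ e * Q = p.map (algebraMap A B)) (hQ : ¬ Q ≤ P) : ¬ P ^ e ∣ differentIdeal A B := by
  have hcop : IsCoprime (P ^ e) Q := by
    refine IsCoprime.pow_left ?_
    rw [Ideal.isCoprime_iff_sup_eq]
    exact hP.1.2 _ (left_lt_sup.2 hQ)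
  -- The Chinese remainder idempotent: `x` is `1` modulo `P ^ e` and `0` modulo `Q`. Its trace
  -- modulo `p` is nonzero, whereas divisibility of the different by `P ^ e` would put the trace of
  -- every element of `Q` in `p`.
  obtain ⟨y, hy, x, hx, hxy⟩ := Ideal.isCoprime_iff_exists.1 hcop
  refine not_dvd_differentIdeal_of_intTrace_not_mem A (P ^ e) Q hPQ x hx ?_
  rw [← Ideal.Quotient.eq_zero_iff_mem, ← Algebra.trace_quotient_eq_of_isDedekindDomain]
  set z := Ideal.Quotient.mk (p.map (algebraMap A B)) x with hz
  have hid : IsIdempotentElem z := by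
    rw [IsIdempotentElem, hz, ← map_mul, Ideal.Quotient.eq, ← hPQ]
    have : x * x - x = y * (-x) := by linear_combination x * hxy
    rw [this]
    exact Ideal.mul_mem_mul hy (neg_mem hx)
  have hz0 : z ≠ 0 := by
    rw [hz, ne_eq, Ideal.Quotient.eq_zero_iff_mem, ← hPQ]
    intro h
    refine hP.ne_top ((Ideal.eq_top_iff_one P).2 ?_)
    rw [← hxy]
    exact Ideal.pow_le_self he (add_mem hy (Ideal.mul_le_left h))
  exact Algebra.trace_ne_zero_of_isIdempotentElem
    ((Ideal.Quotient.maximal_ideal_iff_isField_quotient p).1 hp) hid hz0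

end Tame

end TraceOfIdempotent

/-! ### Derivations and the different. -/

section DifferentialDifferent

open KaehlerDifferential Polynomial

section DifferentOfDerivation

variable {k B K : Type*} [Field k] [IsAlgClosed k] [CharZero k] [CommRing B] [IsDedekindDomain B]
  [Algebra k B] [Algebra k[X] B] [IsScalarTower k k[X] B] [Module.Finite k[X] B]
  [Module.IsTorsionFree k[X] B] [Field K] [Algebra B K]
  [Algebra k K] [IsScalarTower k B K]

attribute [local instance] FractionRing.liftAlgebra FractionRing.isScalarTower_liftAlgebra

/-- Near a closed point, the derivative of `X` agrees up to a unit with the derivative of a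
uniformizer times a generator of the different. -/
theorem Derivation.exists_uniformizer_differentIdeal (d : Derivation k B K) {P : Ideal B}
    (hP : P.IsMaximal) : ∃ t ∈ P, t ∉ P ^ 2 ∧ ∃ n : ℕ, P ^ n ∣ differentIdeal k[X] B ∧
      ¬ P ^ (n + 1) ∣ differentIdeal k[X] B ∧
      (∃ s ∉ P, ∀ u : B, ∃ b : B, s • d u = b • d t) ∧
      ∃ s ∉ P, ∃ γ ∉ P, s • d (algebraMap k[X] B X) = (γ * t ^ n) • d t := by
  have : Algebra.FiniteType k B := Algebra.FiniteType.trans (S := k[X]) inferInstance inferInstance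
  have : FiniteDimensional (FractionRing k[X]) (FractionRing B) :=
    have : IsLocalization (Algebra.algebraMapSubmonoid B (nonZeroDivisors k[X])) (FractionRing B) :=
      IsIntegralClosure.isLocalization _ (FractionRing k[X]) _ _
    .of_isLocalization k[X] B (nonZeroDivisors k[X])
  have : CharZero (FractionRing k[X]) :=
    charZero_of_injective_algebraMap (IsFractionRing.injective k[X] (FractionRing k[X]))
  have : Algebra.IsSeparable (FractionRing k[X]) (FractionRing B) := inferInstance
  obtain ⟨a, ha⟩ := hP.exists_sub_algebraMap_mem k (algebraMap k[X] B X)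
  set z := algebraMap k[X] B (X - C a) with hz
  have hzP : z ∈ P := by
    rw [hz, map_sub]
    convert! ha using 2
    rw [IsScalarTower.algebraMap_apply k k[X] B]
    rfl
  have hz0 : z ≠ 0 := by
    rw [hz, ne_eq, FaithfulSMul.algebraMap_eq_zero_iff]
    exact X_sub_C_ne_zero a
  have hPbot : P ≠ ⊥ := by
    rintro rfl
    exact hz0 (by simpa using hzP)
  have hPprime := hP.isPrime
  obtain ⟨t, ht, ht'⟩ := hP.exists_mem_notMem_sq hPbot
  let p : Ideal k[X] := Ideal.span {X - C a}
  have hp : p.IsMaximal :=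
    PrincipalIdealRing.isMaximal_of_irreducible (irreducible_X_sub_C a)
  have : CharZero (k[X] ⧸ p) :=
    charZero_of_injective_algebraMap (FaithfulSMul.algebraMap_injective k (k[X] ⧸ p))
  have hmap : p.map (algebraMap k[X] B) = Ideal.span {z} := by
    rw [Ideal.map_span, Set.image_singleton]
  obtain ⟨e, Q, hQ, hPQ⟩ : ∃ (e : ℕ) (Q : Ideal B), ¬ Q ≤ P ∧ Ideal.span {z} = P ^ e * Q := by
    have hfin : FiniteMultiplicity P (Ideal.span {z}) := by
      refine FiniteMultiplicity.of_not_isUnit ?_ (by simpa using hz0)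
      rw [Ideal.isUnit_iff]
      exact hP.ne_top
    obtain ⟨Q, hQ, hQ'⟩ := hfin.exists_eq_pow_mul_and_not_dvd
    exact ⟨_, Q, fun h => hQ' (Ideal.dvd_iff_le.2 h), hQ⟩
  have he : e ≠ 0 := by
    rintro rfl
    apply hQ
    rw [pow_zero, one_mul] at hPQ
    rwa [← hPQ, Ideal.span_singleton_le_iff_mem]
  obtain ⟨n, rfl⟩ := Nat.exists_eq_succ_of_ne_zero he
  obtain ⟨s, hs, hst⟩ := exists_notMem_forall_smul_mem_span_D k hP ht ht'
  have hst' : ∀ u : B, ∃ b : B, s • d u = b • d t := by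
    intro u
    obtain ⟨b, hb⟩ := Submodule.mem_span_singleton.1 (hst (D k B u))
    refine ⟨b, ?_⟩
    have := congrArg d.liftKaehlerDifferential hb
    simpa using this.symm
  obtain ⟨s₁, hs₁, w, hw, hsw⟩ := hPprime.exists_mul_eq_mul_pow ht ht' (n := n + 1) (z := z)
    (by
      rw [← Ideal.span_singleton_le_iff_mem, hPQ]
      exact Ideal.mul_le_left)
    (by
      rw [← Ideal.span_singleton_le_iff_mem, hPQ, ← Ideal.dvd_iff_le, pow_succ P (n + 1)]
      intro h
      exact hQ (Ideal.dvd_iff_le.1 ((mul_dvd_mul_iff_left (pow_ne_zero _ hPbot)).1 h)))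
  -- The ramification index is `n + 1`, so the exponent of the different is `n`.
  refine ⟨t, ht, ht', n, ?_, ?_, ⟨s, hs, hst'⟩, ?_⟩
  · have : p ≠ ⊥ := by simpa [p] using X_sub_C_ne_zero a
    exact pow_sub_one_dvd_differentIdeal k[X] P (n + 1) this ⟨Q, hmap.trans hPQ⟩
  · exact not_pow_dvd_differentIdeal_of_charZero he (hPQ.symm.trans hmap.symm) hQ
  · obtain ⟨α, hα⟩ := hst' s₁
    obtain ⟨β, hβ⟩ := hst' w
    have hdz : d z = d (algebraMap k[X] B X) := by
      have : algebraMap k[X] B (C a) = algebraMap k B a :=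
        (IsScalarTower.algebraMap_apply k k[X] B a).symm
      rw [hz, map_sub, map_sub, this, d.map_algebraMap, sub_zero]
    have hd := congrArg d hsw
    rw [Derivation.leibniz, Derivation.leibniz, Derivation.leibniz_pow, hdz,
      Nat.add_sub_cancel, ← Nat.cast_smul_eq_nsmul B] at hd
    -- Differentiate `s₁ z = w t ^ (n + 1)`, multiply by `s s₁`, and express `s d s₁` and `s d w`
    -- through `d t`. The resulting `γ` is congruent to `(n + 1) s s₁ w` modulo `P`, hence not in
    -- `P` because `n + 1` is invertible in `k`.
    refine ⟨s * s₁ ^ 2, ?_, s * s₁ * w * (n + 1 : ℕ) + t * (s₁ * β - w * α), ?_, ?_⟩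
    · exact fun h => (hPprime.mem_or_mem h).elim hs fun h => hs₁ (hPprime.mem_of_pow_mem _ h)
    · intro h
      have h' : s * s₁ * w * ((n + 1 : ℕ) : B) ∈ P := by
        simpa using sub_mem h (Ideal.mul_mem_right (s₁ * β - w * α) P ht)
      refine (hPprime.mem_or_mem h').elim (fun h => (hPprime.mem_or_mem h).elim
        (fun h => (hPprime.mem_or_mem h).elim hs hs₁) hw) fun h => hP.ne_top ?_
      refine Ideal.eq_top_of_isUnit_mem P h ?_
      rw [← _root_.map_natCast (algebraMap k B)]
      exact (IsUnit.mk0 _ (Nat.cast_ne_zero.2 (Nat.succ_ne_zero n))).map _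
    · have hsw' := congrArg (algebraMap B K) hsw
      simp only [Algebra.smul_def, map_mul, map_pow, map_add, map_sub] at hd hα hβ hsw' ⊢
      linear_combination algebraMap B K s * algebraMap B K s₁ * hd -
        algebraMap B K s * d s₁ * hsw' - algebraMap B K w * algebraMap B K t ^ (n + 1) * hα +
        algebraMap B K s₁ * algebraMap B K t ^ (n + 1) * hβ

/-- The derivatives of the regular functions generate the inverse of the different, up to the
factor `d X`. -/
theorem Derivation.span_range_mul_differentIdeal [IsFractionRing B K] (d : Derivation k B K) :
    Submodule.span B (Set.range d) * IsLocalization.coeSubmodule K (differentIdeal k[X] B) =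
      Submodule.span B {d (algebraMap k[X] B X)} := by
  apply le_antisymm
  · rw [← Submodule.le_div_iff_mul_le, Submodule.span_le]
    rintro _ ⟨u, rfl⟩
    rw [SetLike.mem_coe, Submodule.mem_div_iff_forall_mul_mem]
    intro x hx
    obtain ⟨y, hy, rfl⟩ := (IsLocalization.mem_coeSubmodule K _).1 hx
    refine Submodule.mem_of_forall_isMaximal fun P hP => ?_
    obtain ⟨t, ht, ht', n, hn, hn', ⟨s, hs, hst⟩, s', hs', γ, hγ, h⟩ :=
      d.exists_uniformizer_differentIdeal hP
    obtain ⟨b, hb⟩ := hst u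
    obtain ⟨s₁, hs₁, w, hw⟩ := hP.isPrime.exists_mul_eq_mul_pow_of_mem_pow ht ht'
      (Ideal.dvd_iff_le.1 hn hy)
    refine ⟨γ * s * s₁, fun h => (hP.isPrime.mem_or_mem h).elim
      (fun h => (hP.isPrime.mem_or_mem h).elim hγ hs) hs₁, ?_⟩
    refine Submodule.mem_span_singleton.2 ⟨b * w * s', ?_⟩
    have hw' := congrArg (algebraMap B K) hw
    simp only [Algebra.smul_def, map_mul, map_pow] at hb h hw' ⊢
    linear_combination algebraMap B K b * algebraMap B K w * h -
      algebraMap B K γ * algebraMap B K s₁ * algebraMap B K y * hb -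
      algebraMap B K γ * algebraMap B K b * d t * hw'
  · rw [Submodule.span_singleton_le_iff_mem]
    refine Submodule.mem_of_forall_isMaximal fun P hP => ?_
    obtain ⟨t, ht, ht', n, hn, hn', ⟨s, hs, hst⟩, s', hs', γ, hγ, h⟩ :=
      d.exists_uniformizer_differentIdeal hP
    obtain ⟨j, hj, hjt⟩ := Ideal.exists_notMem_mul_pow_mem ht hn hn'
    refine ⟨j * s', fun h => (hP.isPrime.mem_or_mem h).elim hj hs', ?_⟩
    have : (j * s') • d (algebraMap k[X] B X) = (γ • d t) * algebraMap B K (j * t ^ n) := by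
      simp only [Algebra.smul_def, map_mul, map_pow] at h ⊢
      linear_combination algebraMap B K j * h
    rw [this]
    exact Submodule.mul_mem_mul (Submodule.smul_mem _ _ (Submodule.subset_span ⟨t, rfl⟩))
      ((IsLocalization.mem_coeSubmodule K _).2 ⟨_, hjt, rfl⟩)

end DifferentOfDerivation

end DifferentialDifferent

/-! ### Trace duality for a monogenic order. -/

section Monogenic

open KaehlerDifferential Polynomial

theorem Submodule.nonempty_quotient_submoduleOf_equiv {A S V W : Type*} [CommRing A] [CommRing S]
    [Algebra A S] [AddCommGroup V] [Module A V] [Module S V] [IsScalarTower A S V] [AddCommGroup W]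
    [Module A W] {U : Submodule S V} {P Q : Submodule A W} (f : V →ₗ[A] W)
    (hP : LinearMap.range f = P) (hQ : ∀ v, f v ∈ Q ↔ v ∈ U) :
    Nonempty ((P ⧸ Q.submoduleOf P) ≃ₗ[A] V ⧸ U) := by
  subst hP
  let g := (Q.submoduleOf (LinearMap.range f)).mkQ ∘ₗ f.rangeRestrict
  have hg : Function.Surjective g :=
    (Submodule.mkQ_surjective _).comp f.surjective_rangeRestrict
  have hker : LinearMap.ker g = U.restrictScalars A := by
    ext v
    rw [LinearMap.mem_ker, Submodule.restrictScalars_mem, ← hQ]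
    exact Submodule.Quotient.mk_eq_zero _
  exact ⟨(g.quotKerEquivOfSurjective hg).symm.trans
    ((Submodule.quotEquivOfEq _ _ hker).trans (Submodule.Quotient.restrictScalarsEquiv A U))⟩

theorem Algebra.span_adjoin_singleton_eq_top {A K L : Type*} [CommRing A] [Field K] [Field L]
    [Algebra K L] [Algebra A L] {y : L} (hy : Algebra.adjoin K {y} = ⊤) :
    Submodule.span K (Algebra.adjoin A {y} : Set L) = ⊤ := by
  refine top_le_iff.1 ?_
  rw [← Algebra.top_toSubmodule (R := K), ← hy, Algebra.adjoin_eq_span]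
  refine Submodule.span_mono fun x hx => ?_
  refine Submonoid.closure_le (S := (Algebra.adjoin A {y}).toSubmonoid).2 ?_ hx
  exact Algebra.subset_adjoin

section Duality

variable {A K L B R : Type*} [CommRing A] [Field K] [Algebra A K]
  [Field L] [Algebra K L] [Algebra A L] [IsScalarTower A K L] [CommRing B] [Algebra A B]
  [Algebra B L] [IsScalarTower A B L] [CommRing R] [Algebra A R] [Algebra R B]
  [IsScalarTower A R B] [Algebra R L] [IsScalarTower R B L] [IsScalarTower A R L]

/-- As `y` is algebraic, `K[y]` is already a field; it contains `R`, hence all fractions of `R`. -/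
theorem IsFractionRing.adjoin_algebraMap_eq_top [IsFractionRing R L] {y : R}
    (hy : Algebra.adjoin A {y} = ⊤) (hint : IsIntegral K (algebraMap R L y)) :
    Algebra.adjoin K {algebraMap R L y} = ⊤ := by
  have hR : ∀ r : R, algebraMap R L r ∈ Algebra.adjoin K {algebraMap R L y} := by
    intro r
    have hr : r ∈ Algebra.adjoin A {y} := hy ▸ Algebra.mem_top
    induction hr using Algebra.adjoin_induction with
    | mem x hx =>
      rw [Set.mem_singleton_iff.1 hx]
      exact Algebra.subset_adjoin rfl
    | algebraMap a =>
      rw [← IsScalarTower.algebraMap_apply, IsScalarTower.algebraMap_apply A K L]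
      exact Subalgebra.algebraMap_mem _ _
    | add x x' _ _ h h' => rw [map_add]; exact add_mem h h'
    | mul x x' _ _ h h' => rw [map_mul]; exact mul_mem h h'
  rw [eq_top_iff]
  rintro x -
  rw [← IntermediateField.adjoin_simple_toSubalgebra_of_isAlgebraic hint.isAlgebraic] at hR ⊢
  obtain ⟨r, s, hs, rfl⟩ := IsFractionRing.div_surjective (A := R) x
  exact (IntermediateField.adjoin K {algebraMap R L y}).div_mem (hR r) (hR s)

variable [IsDomain A] [IsFractionRing A K] [IsPrincipalIdealRing A] [FiniteDimensional K L] [Algebra.IsSeparable K L]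
  [IsIntegralClosure B A L]

variable (A K L B) in
/-- The Gorenstein property of a monogenic order: the conductor in the integral closure has the
same colength as the order has in its integral closure. -/
theorem Algebra.length_quotient_conductor {y : R} (hy : Algebra.adjoin A {y} = ⊤)
    (hyL : Algebra.adjoin K {algebraMap R L y} = ⊤) (hRB : Function.Injective (algebraMap R B))
    {𝔠 : Ideal R} (h𝔠 : ∀ r, r ∈ 𝔠 ↔ ∀ b : B, ∃ c : R, algebraMap R B c = r • b) :
    Module.length A (R ⧸ 𝔠) = Module.length A (B ⧸ LinearMap.range (Algebra.linearMap R B)) := by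
  have hBL : Function.Injective (algebraMap B L) := IsIntegralClosure.algebraMap_injective B A L
  have hRL : Function.Injective (algebraMap R L) := by
    rw [IsScalarTower.algebraMap_eq R B L]
    exact hBL.comp hRB
  have hint : IsIntegral A (algebraMap R L y) := by
    rw [IsScalarTower.algebraMap_apply R B L]
    exact (IsIntegralClosure.isIntegral A L (algebraMap R B y)).algebraMap
  have : Module.Finite A B := IsIntegralClosure.finite A K L B
  let M : Submodule A L := LinearMap.range (IsScalarTower.toAlgHom A B L).toLinearMap
  let N : Submodule A L := Subalgebra.toSubmodule (Algebra.adjoin A {algebraMap R L y})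
  have hN : N = LinearMap.range (IsScalarTower.toAlgHom A R L).toLinearMap := by
    have := congrArg Subalgebra.toSubmodule (AlgHom.map_adjoin (IsScalarTower.toAlgHom A R L) {y})
    rw [hy, Set.image_singleton, Algebra.map_top] at this
    exact this.symm
  have hmemN : ∀ x, x ∈ N ↔ ∃ r : R, algebraMap R L r = x := by
    intro x; rw [hN]; rfl
  have hNM : N ≤ M := by
    intro x hx
    obtain ⟨r, rfl⟩ := (hmemN x).1 hx
    exact ⟨algebraMap R B r, (IsScalarTower.algebraMap_apply R B L r).symm⟩
  have hMfg : M.FG := Module.Finite.iff_fg.1 (Module.Finite.range _)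
  have hNspan : Submodule.span K (N : Set L) = ⊤ := Algebra.span_adjoin_singleton_eq_top hyL
  set φ := aeval (algebraMap R L y) (derivative (minpoly K (algebraMap R L y))) with hφ
  have hφ0 : φ ≠ 0 :=
    (Algebra.IsSeparable.isSeparable K (algebraMap R L y)).aeval_derivative_ne_zero
      (minpoly.aeval _ _)
  -- Euler's formula for the trace dual of `A[y]`, with `φ = F'(y)`.
  have hmemdual : ∀ x, x ∈ (Algebra.traceForm K L).dualSubmodule N ↔ ∃ r : R,
      φ⁻¹ * algebraMap R L r = x := by
    intro x
    rw [traceForm_dualSubmodule_adjoin A K hyL hint, Submodule.mem_smul_pointwise_iff_exists]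
    constructor
    · rintro ⟨b, hb, rfl⟩
      obtain ⟨r, rfl⟩ := (hmemN b).1 hb
      exact ⟨r, rfl⟩
    · rintro ⟨r, rfl⟩
      exact ⟨_, (hmemN _).2 ⟨r, rfl⟩, rfl⟩
  -- The dual of `M` is the largest `B`-submodule of the dual of `N`; by `hmemdual` it is `φ⁻¹ 𝔠`.
  have hmemdualM : ∀ x, x ∈ (Algebra.traceForm K L).dualSubmodule M ↔
      ∀ b : B, algebraMap B L b * x ∈ (Algebra.traceForm K L).dualSubmodule N := by
    intro x
    simp only [LinearMap.BilinForm.mem_dualSubmodule, Algebra.traceForm_apply]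
    constructor
    · intro h b n hn
      obtain ⟨b', rfl⟩ := hNM hn
      have := h _ ⟨b * b', rfl⟩
      convert! this using 2
      simp
      ring
    · rintro h _ ⟨b, rfl⟩
      have := h b 1 ((hmemN 1).2 ⟨1, map_one _⟩)
      rwa [mul_one, mul_comm] at this
  have hlen := LinearMap.BilinForm.length_quotient_dualSubmodule (traceForm_nondegenerate K L) hNM
    hMfg hNspan
  obtain ⟨e₁⟩ := Submodule.nonempty_quotient_submoduleOf_equiv
    (U := LinearMap.range (Algebra.linearMap R B)) (P := M) (Q := N)
    (IsScalarTower.toAlgHom A B L).toLinearMap rfl (by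
      intro b
      rw [hmemN]
      constructor
      · rintro ⟨r, hr⟩
        exact ⟨r, hBL ((IsScalarTower.algebraMap_apply R B L r).symm.trans hr)⟩
      · rintro ⟨r, rfl⟩
        exact ⟨r, IsScalarTower.algebraMap_apply R B L r⟩)
  obtain ⟨e₂⟩ := Submodule.nonempty_quotient_submoduleOf_equiv (U := 𝔠)
    (P := (Algebra.traceForm K L).dualSubmodule N) (Q := (Algebra.traceForm K L).dualSubmodule M)
    (LinearMap.mulLeft A φ⁻¹ ∘ₗ (IsScalarTower.toAlgHom A R L).toLinearMap)
    (by ext x; rw [hmemdual]; rfl) (by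
      intro r
      rw [hmemdualM, h𝔠]
      refine forall_congr' fun b => ?_
      rw [hmemdual]
      refine exists_congr fun c => ?_
      rw [← hBL.eq_iff, ← IsScalarTower.algebraMap_apply, Algebra.smul_def, map_mul,
        ← IsScalarTower.algebraMap_apply]
      change φ⁻¹ * _ = _ * (φ⁻¹ * algebraMap R L r) ↔ _
      rw [mul_left_comm, mul_right_inj' (inv_ne_zero hφ0), mul_comm])
  rw [← e₁.length_eq, ← e₂.length_eq, hlen]

end Duality

end Monogenic

/-! ### The conductor of a monogenic order over `k[X]`. -/

section ConductorOfOrder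

open KaehlerDifferential Polynomial

theorem IsLocalization.coeSubmodule_mul_right_cancel {B K : Type*} [CommRing B] [IsDedekindDomain B]
    [Field K] [Algebra B K] [IsFractionRing B K] {I : Ideal B} (hI : I ≠ ⊥) {M N : Submodule B K}
    (h : M * coeSubmodule K I = N * coeSubmodule K I) : M = N := by
  have hinv : coeSubmodule K I * (((I : FractionalIdeal (nonZeroDivisors B) K)⁻¹ :
      FractionalIdeal (nonZeroDivisors B) K) : Submodule B K) = 1 := by
    rw [← FractionalIdeal.coe_coeIdeal (S := nonZeroDivisors B), ← FractionalIdeal.coe_mul,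
      mul_inv_cancel₀ (by simpa using hI), FractionalIdeal.coe_one]
  have := congrArg (· * (((I : FractionalIdeal (nonZeroDivisors B) K)⁻¹ :
      FractionalIdeal (nonZeroDivisors B) K) : Submodule B K)) h
  simpa only [mul_assoc, hinv, mul_one] using this

section Conductor

variable {k B K : Type*} [Field k] [IsAlgClosed k] [CharZero k] [CommRing B] [IsDedekindDomain B]
  [Algebra k B] [Algebra k[X] B] [IsScalarTower k k[X] B] [Module.Finite k[X] B]
  [Module.IsTorsionFree k[X] B] [Field K] [Algebra B K] [IsFractionRing B K]
  [Algebra k K] [IsScalarTower k B K] [Algebra k[X] K] [IsScalarTower k[X] B K]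

/-- If `d X` generates the same module as `F'(y)`, where `F` is the minimal polynomial of `y`, then
the derivatives of the regular functions generate the conductor of `y`. -/
theorem Derivation.span_range_eq_coeSubmodule_conductor (F : Type*) [Field F] [Algebra k[X] F]
    [IsFractionRing k[X] F] [Algebra F K] [IsScalarTower k[X] F K]
    [FiniteDimensional F K] (d : Derivation k B K) {y : B}
    (hy : Algebra.adjoin F {algebraMap B K y} = ⊤)
    (h : Submodule.span B {d (algebraMap k[X] B X)} =
      Submodule.span B {algebraMap B K (aeval y (derivative (minpoly k[X] y)))}) :
    Submodule.span B (Set.range d) = IsLocalization.coeSubmodule K (conductor k[X] y) := by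
  have : IsIntegralClosure B k[X] K := IsIntegralClosure.of_isIntegrallyClosed B k[X] K
  have : CharZero F :=
    have : CharZero k[X] := inferInstance
    charZero_of_injective_algebraMap (IsFractionRing.injective k[X] F)
  have : Algebra.IsSeparable F K := inferInstance
  have hmul := conductor_mul_differentIdeal k[X] F K y hy
  -- By Dedekind's formula a zero different would force `F'(y) = 0`, against separability.
  have hD : differentIdeal k[X] B ≠ ⊥ := by
    intro h0
    rw [h0, Ideal.mul_bot, eq_comm, Ideal.span_singleton_eq_bot] at hmul
    have h1 := (Algebra.IsSeparable.isSeparable F (algebraMap B K y)).aeval_derivative_ne_zero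
      (minpoly.aeval F (algebraMap B K y))
    rw [minpoly.isIntegrallyClosed_eq_field_fractions F K (Algebra.IsIntegral.isIntegral (R := k[X]) y),
      derivative_map, aeval_map_algebraMap, aeval_algebraMap_apply, hmul, map_zero] at h1
    exact h1 rfl
  refine IsLocalization.coeSubmodule_mul_right_cancel hD ?_
  rw [d.span_range_mul_differentIdeal, h, ← IsLocalization.coeSubmodule_mul, hmul,
    IsLocalization.coeSubmodule_span_singleton]

end Conductor

/-- A nonzero element of `I` is integral over `k[X]`, so `I` contains the image of some `g ≠ 0` in
`k[X]`. Then `R ⧸ I` is finite over `k[X] ⧸ (g)`, hence over `k`. -/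
theorem Ideal.length_quotient_ne_top_of_ne_bot (k : Type*) {R : Type*} [Field k] [IsAlgClosed k]
    [CommRing R] [IsDomain R] [Algebra k R] [Algebra k[X] R] [IsScalarTower k k[X] R]
    [Module.Finite k[X] R] {I : Ideal R} (hI : I ≠ ⊥) : Module.length R (R ⧸ I) ≠ ⊤ := by
  have : Algebra.FiniteType k R := Algebra.FiniteType.trans (S := k[X]) inferInstance inferInstance
  rw [Module.length_eq_length_of_isAlgClosed k]
  obtain ⟨x, hx, hx0⟩ := Submodule.exists_mem_ne_zero_of_ne_bot hI
  obtain ⟨g, hg, hg0⟩ := Submodule.exists_mem_ne_zero_of_ne_bot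
    (Ideal.comap_ne_bot_of_integral_mem (R := k[X]) hx0 hx (Algebra.IsIntegral.isIntegral x))
  obtain ⟨J, hJ, hle⟩ : ∃ J : Ideal k[X], Module.Finite k (k[X] ⧸ J) ∧
      J ≤ I.comap (algebraMap k[X] R) :=
    ⟨Ideal.span {g}, (AdjoinRoot.powerBasis hg0).finite,
      (Ideal.span_singleton_le_iff_mem _).2 hg⟩
  let : Algebra (k[X] ⧸ J) (R ⧸ I) := (Ideal.quotientMap I (algebraMap k[X] R) hle).toAlgebra
  have : IsScalarTower k[X] (k[X] ⧸ J) (R ⧸ I) :=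
    IsScalarTower.of_algebraMap_eq (R := k[X]) (S := k[X] ⧸ J) (A := R ⧸ I) fun a => rfl
  have : IsScalarTower k (k[X] ⧸ J) (R ⧸ I) :=
    IsScalarTower.of_algebraMap_eq (R := k) (S := k[X] ⧸ J) (A := R ⧸ I) fun a =>
      congrArg (Ideal.Quotient.mk I) (IsScalarTower.algebraMap_apply k k[X] R a)
  have : Module.Finite (k[X] ⧸ J) (R ⧸ I) :=
    Module.Finite.of_restrictScalars_finite k[X] (k[X] ⧸ J) (R ⧸ I)
  have : Module.Finite k (R ⧸ I) := Module.Finite.trans (k[X] ⧸ J) (R ⧸ I)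
  exact Module.length_ne_top

section MonogenicOrder

variable {k R K : Type*} [Field k] [IsAlgClosed k] [CharZero k] [CommRing R] [IsDomain R]
  [Algebra k R] [Algebra k[X] R] [IsScalarTower k k[X] R] [Module.Finite k[X] R]
  [Module.IsTorsionFree k[X] R] [Field K] [Algebra R K] [IsFractionRing R K] [Algebra k K]
  [IsScalarTower k R K] [Algebra k[X] K] [IsScalarTower k[X] R K]

theorem isIntegralClosure_integralClosure_of_isIntegral (A : Type*) {R K : Type*} [CommRing A]
    [CommRing R] [Field K] [Algebra A R] [Algebra R K] [Algebra A K] [IsScalarTower A R K]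
    [Algebra.IsIntegral A R] : IsIntegralClosure (integralClosure R K) A K where
  algebraMap_injective := Subtype.val_injective
  isIntegral_iff {x} := by
    constructor
    · intro h
      exact ⟨⟨x, h.tower_top⟩, rfl⟩
    · rintro ⟨y, rfl⟩
      exact isIntegral_trans (R := A) (A := R) _ y.2

theorem IsFractionRing.finiteDimensional_of_adjoin_eq_top {A R K F : Type*} [CommRing A]
    [CommRing R] [Field K] [Field F] [Algebra A R] [Algebra R K] [Algebra A K] [IsScalarTower A R K]
    [Algebra A F] [Algebra F K] [IsScalarTower A F K] [Algebra.IsIntegral A R] [IsFractionRing R K]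
    {y : R} (hy : Algebra.adjoin A {y} = ⊤) :
    FiniteDimensional F K ∧ Algebra.adjoin F {algebraMap R K y} = ⊤ := by
  have hint : IsIntegral F (algebraMap R K y) :=
    ((Algebra.IsIntegral.isIntegral (R := A) y).algebraMap (B := K)).tower_top
  have htop := IsFractionRing.adjoin_algebraMap_eq_top hy hint
  refine ⟨⟨?_⟩, htop⟩
  have := hint.fg_adjoin_singleton
  rwa [htop, Algebra.top_toSubmodule] at this

attribute [local instance] FractionRing.liftAlgebra FractionRing.isScalarTower_liftAlgebra

open IsLocalization in
/-- Let `R = k[X][y]`, let `F` be the minimal polynomial of `y` and let `d` be a derivation with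
`d X = F'(y)` up to a unit. Then the derivatives of the elements of the normalization generate the
conductor, which has the same colength in `R` as `R` has in the normalization. -/
theorem MonogenicOrder.conductor_eq_and_length_eq {y : R} (hy : Algebra.adjoin k[X] {y} = ⊤) (d : Derivation k K K)
    (hd : ∃ v : Rˣ, d (algebraMap R K (algebraMap k[X] R X)) =
      algebraMap R K (v * aeval y (derivative (minpoly k[X] y))))
    {𝔠 : Ideal R} (h𝔠 : ∀ r, r ∈ 𝔠 ↔ ∀ b : integralClosure R K, ∃ c : R,
      algebraMap R (integralClosure R K) c = r • b) :
    ((Submodule.span (integralClosure R K) (Set.range fun b : integralClosure R K => d b) : Set K) =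
      algebraMap R K '' 𝔠) ∧
    d (algebraMap R K (algebraMap k[X] R X)) ≠ 0 ∧
    (Nontrivial Ω[K⁄k] → Function.Injective
      (KaehlerDifferential.map k k (integralClosure R K) K)) ∧
    Module.length R (R ⧸ 𝔠) = Module.length R (integralClosure R K ⧸
      LinearMap.range (Algebra.linearMap R (integralClosure R K))) := by
  have hRK : Function.Injective (algebraMap R K) := IsFractionRing.injective R K
  have hAR : Function.Injective (algebraMap k[X] R) := FaithfulSMul.algebraMap_injective _ _
  have : FaithfulSMul k[X] K := by
    rw [faithfulSMul_iff_algebraMap_injective, IsScalarTower.algebraMap_eq k[X] R K]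
    exact hRK.comp hAR
  have : IsScalarTower k k[X] K := IsScalarTower.of_algebraMap_eq fun a => by
    rw [IsScalarTower.algebraMap_apply k[X] R K, ← IsScalarTower.algebraMap_apply k k[X] R,
      ← IsScalarTower.algebraMap_apply]
  let F := FractionRing k[X]
  obtain ⟨hfd, htop⟩ := IsFractionRing.finiteDimensional_of_adjoin_eq_top (F := F) (K := K) hy
  have : CharZero F := charZero_of_injective_algebraMap (IsFractionRing.injective k[X] F)
  have : Algebra.IsSeparable F K := inferInstance
  let B := integralClosure R K
  have : IsIntegralClosure B k[X] K := isIntegralClosure_integralClosure_of_isIntegral k[X]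
  have hRB : Function.Injective (algebraMap R B) := FaithfulSMul.algebraMap_injective R B
  have : IsDedekindDomain B := IsIntegralClosure.isDedekindDomain k[X] F K B
  have : IsFractionRing B K := IsIntegralClosure.isFractionRing_of_finite_extension k[X] F K B
  have : Module.Finite k[X] B := IsIntegralClosure.finite k[X] F K B
  have : Module.IsTorsionFree k[X] B := by
    have : FaithfulSMul k[X] B := by
      rw [faithfulSMul_iff_algebraMap_injective, IsScalarTower.algebraMap_eq k[X] R B]
      exact hRB.comp hAR
    infer_instance
  have : IsScalarTower k k[X] B := inferInstance
  have : Algebra.FiniteType k B := Algebra.FiniteType.trans (S := k[X]) inferInstance inferInstance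
  have : Algebra.FiniteType k R := Algebra.FiniteType.trans (S := k[X]) inferInstance inferInstance
  have hBK : Function.Injective (algebraMap B K) := Subtype.val_injective
  let dB : Derivation k B K := d.compAlgebraMap B
  have hyB : IsIntegral k[X] y := Algebra.IsIntegral.isIntegral y
  have hmin : minpoly k[X] (algebraMap R B y) = minpoly k[X] y :=
    minpoly.algebraMap_eq hRB y
  have htop' : Algebra.adjoin F {algebraMap B K (algebraMap R B y)} = ⊤ := htop
  obtain ⟨v, hv⟩ := hd
  have hdX : dB (algebraMap k[X] B X) = algebraMap R B v • algebraMap B K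
      (aeval (algebraMap R B y) (derivative (minpoly k[X] (algebraMap R B y)))) := by
    have h1 : algebraMap B K (algebraMap k[X] B X) = algebraMap R K (algebraMap k[X] R X) := by
      rw [← IsScalarTower.algebraMap_apply, ← IsScalarTower.algebraMap_apply]
    refine (congrArg d h1).trans (hv.trans ?_)
    rw [hmin, aeval_algebraMap_apply, Algebra.smul_def, ← map_mul, ← map_mul]
    rfl
  have hspan := dB.span_range_eq_coeSubmodule_conductor F htop' (by
    rw [hdX]
    exact Submodule.span_singleton_group_smul_eq B (v.map (algebraMap R B).toMonoidHom) _)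
  have hφ : aeval (algebraMap R B y) (derivative (minpoly k[X] (algebraMap R B y))) ≠ 0 := by
    intro h0
    have h1 := (Algebra.IsSeparable.isSeparable F (algebraMap R K y)).aeval_derivative_ne_zero
      (minpoly.aeval F (algebraMap R K y))
    have h2 : algebraMap R K y = algebraMap B K (algebraMap R B y) := rfl
    rw [h2, minpoly.isIntegrallyClosed_eq_field_fractions F K (hyB.algebraMap (B := B)),
      derivative_map, aeval_map_algebraMap, aeval_algebraMap_apply, h0, map_zero] at h1
    exact h1 rfl
  have hB : ¬ IsField B := by
    intro h
    have := isField_of_isIntegral_of_isField (FaithfulSMul.algebraMap_injective k[X] B) h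
    exact Polynomial.not_isField k this
  -- `conductor` is an ideal of `B` and `𝔠` an ideal of `R`; they are the same set, since `1 ∈ B`
  -- forces a conductor element into `R`.
  have hcond : ∀ b : B, b ∈ conductor k[X] (algebraMap R B y) ↔
      ∃ c ∈ 𝔠, algebraMap R B c = b := by
    have hadj : ∀ b : B, b ∈ Algebra.adjoin k[X] {algebraMap R B y} ↔
        ∃ r : R, algebraMap R B r = b := by
      intro b
      have := AlgHom.map_adjoin (IsScalarTower.toAlgHom k[X] R B) {y}
      rw [hy, Set.image_singleton] at this
      have h2 : Algebra.adjoin k[X] {algebraMap R B y} = _ := this.symm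
      rw [h2]
      simp
    intro b
    rw [mem_conductor_iff]
    simp only [hadj]
    constructor
    · intro h
      obtain ⟨c, hc⟩ := h 1
      refine ⟨c, (h𝔠 c).2 fun b' => ?_, by rw [hc, mul_one]⟩
      obtain ⟨r, hr⟩ := h b'
      exact ⟨r, by rw [hr, Algebra.smul_def, hc, mul_one]⟩
    · rintro ⟨c, hc, rfl⟩ b'
      obtain ⟨r, hr⟩ := (h𝔠 c).1 hc b'
      exact ⟨r, by rw [hr, Algebra.smul_def]⟩
  refine ⟨?_, ?_, fun hK => ?_, ?_⟩
  · refine (congrArg SetLike.coe hspan).trans ?_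
    ext z
    rw [SetLike.mem_coe, IsLocalization.mem_coeSubmodule]
    constructor
    · rintro ⟨b, hb, rfl⟩
      obtain ⟨c, hc, rfl⟩ := (hcond b).1 hb
      exact ⟨c, hc, rfl⟩
    · rintro ⟨c, hc, rfl⟩
      exact ⟨algebraMap R B c, (hcond _).2 ⟨c, hc, rfl⟩, rfl⟩
  · rw [hv, ne_eq, FaithfulSMul.algebraMap_eq_zero_iff, v.mul_right_eq_zero]
    intro h0
    apply hφ
    rw [hmin, aeval_algebraMap_apply, h0, map_zero]
  · refine KaehlerDifferential.map_fractionField_injective k hB hK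
  -- Duality gives lengths over `k[X]`; both these and lengths over `R` are dimensions over `k`.
  · rw [Module.length_eq_length_of_isAlgClosed k (S := R),
      Module.length_eq_length_of_isAlgClosed k (S := R),
      ← Module.length_eq_length_of_isAlgClosed k (S := k[X]),
      ← Module.length_eq_length_of_isAlgClosed k (S := k[X])]
    exact Algebra.length_quotient_conductor k[X] F K B hy htop hRB h𝔠

end MonogenicOrder

end ConductorOfOrder

/-! ### Linear change of coordinates. -/

section Coordinates

open Polynomial

namespace PlaneCurve

section Shear

variable {k : Type*} [Field k]

/-- The polynomial `X + c Y`. -/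
noncomputable def shearCoord (c : k) : MvPolynomial (Fin 2) k :=
  MvPolynomial.X 0 + MvPolynomial.C c * MvPolynomial.X 1

/-- The homomorphism `k[x'][Y] → k[X, Y]`, `x' ↦ X + c Y`. -/
noncomputable def unshear (c : k) : k[X][X] →+* MvPolynomial (Fin 2) k :=
  eval₂RingHom (aeval (shearCoord c) : k[X] →ₐ[k] MvPolynomial (Fin 2) k).toRingHom
    (MvPolynomial.X 1)

/-- The homomorphism `k[X, Y] → k[x'][Y]`, `X ↦ x' - c Y`, inverse to `unshear c`. -/
noncomputable def shear (c : k) : MvPolynomial (Fin 2) k →ₐ[k] k[X][X] :=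
  MvPolynomial.aeval ![C X - C (C c) * X, X]

theorem unshear_C (c : k) (p : k[X]) : unshear c (C p) = aeval (shearCoord c) p := by
  simp [unshear]

theorem unshear_X (c : k) : unshear c X = MvPolynomial.X 1 := by
  simp [unshear]

theorem unshear_shear (c : k) (h : MvPolynomial (Fin 2) k) : unshear c (shear c h) = h := by
  induction h using MvPolynomial.induction_on with
  | C a =>
    rw [← MvPolynomial.algebraMap_eq, AlgHom.commutes, IsScalarTower.algebraMap_apply k k[X] k[X][X],
      algebraMap_eq, unshear_C, algebraMap_eq, aeval_C]
  | add p q hp hq => rw [map_add, map_add, hp, hq]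
  | mul_X p i hp =>
    rw [map_mul, map_mul, hp]
    congr 1
    fin_cases i <;> simp [shear, unshear_C, unshear_X, shearCoord, ← MvPolynomial.algebraMap_eq]

theorem shear_unshear (c : k) (g : k[X][X]) : shear c (unshear c g) = g := by
  have : ((shear c : MvPolynomial (Fin 2) k →+* k[X][X]).comp (unshear c)) = RingHom.id _ := by
    refine Polynomial.ringHom_ext' (Polynomial.ringHom_ext' ?_ ?_) ?_
    · ext a
      simp [unshear_C, shear]
    · simp [unshear_C, shear, shearCoord, IsScalarTower.algebraMap_apply k k[X] k[X][X]]
    · simp [unshear_X, shear]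
  exact congrArg (fun φ => φ g) this

theorem unshear_dvd_unshear {c : k} {g h : k[X][X]} : unshear c g ∣ unshear c h ↔ g ∣ h := by
  refine ⟨fun hd => ?_, map_dvd _⟩
  simpa only [AlgHom.coe_toRingHom, shear_unshear] using map_dvd (shear c) hd

/-- The jacobian of `X + c Y` is the partial derivative with respect to the second coordinate. -/
theorem jacobian_unshear_shearCoord (c : k) (g : k[X][X]) :
    jacobian (unshear c g) (shearCoord c) = unshear c (derivative g) := by
  -- `∂_Y - c ∂_X` kills `X + cY` and sends `Y` to `1`, so it is the derivative in `Y` with `X + cY`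
  -- held constant.
  let δ : Derivation k (MvPolynomial (Fin 2) k) (MvPolynomial (Fin 2) k) :=
    MvPolynomial.pderiv 1 - (MvPolynomial.C c : MvPolynomial (Fin 2) k) • MvPolynomial.pderiv 0
  have h0 : MvPolynomial.pderiv 0 (shearCoord c) = 1 := by
    simp [shearCoord, MvPolynomial.pderiv_X]
  have h1 : MvPolynomial.pderiv 1 (shearCoord c) = MvPolynomial.C c := by
    simp [shearCoord, MvPolynomial.pderiv_X]
  have hδ : ∀ h, jacobian h (shearCoord c) = δ h := by
    intro h
    simp only [jacobian, h0, h1, one_mul]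
    rfl
  have hδC : ∀ p : k[X], δ (unshear c (C p)) = 0 := by
    intro p
    have : δ (shearCoord c) = 0 := by
      change MvPolynomial.pderiv 1 (shearCoord c) -
        MvPolynomial.C c * MvPolynomial.pderiv 0 (shearCoord c) = 0
      rw [h0, h1, mul_one, sub_self]
    rw [unshear_C, Derivation.map_aeval, this, smul_zero]
  have hδX : δ (unshear c X) = 1 := by
    rw [unshear_X]
    change MvPolynomial.pderiv 1 (MvPolynomial.X 1 : MvPolynomial (Fin 2) k) -
        MvPolynomial.C c * MvPolynomial.pderiv 0 (MvPolynomial.X 1) = 1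
    simp [MvPolynomial.pderiv_X]
  rw [hδ]
  induction g using Polynomial.induction_on' with
  | add p q hp hq => simp only [map_add, hp, hq]
  | monomial n a =>
    rw [← C_mul_X_pow_eq_monomial, derivative_C_mul_X_pow, map_mul, map_pow, Derivation.leibniz,
      Derivation.leibniz_pow, hδC, hδX]
    simp
    ring

/-- After a suitable shear, a nonzero polynomial has a unit as leading coefficient. -/
theorem exists_coeff_shear_eq [Infinite k] {f : MvPolynomial (Fin 2) k} (hf : f ≠ 0) :
    ∃ c r : k, r ≠ 0 ∧ (shear c f).natDegree ≤ f.totalDegree ∧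
      (shear c f).coeff f.totalDegree = C r := by
  set N := f.totalDegree with hN
  -- The top-degree form of `f` at `Y = 1`. Since `X` goes to `x' - cY`, the coefficient of `Y ^ N`
  -- in the sheared polynomial is `q(-c)`, nonzero for some `c` in the infinite field.
  let q : k[X] := ∑ m ∈ f.support with m 0 + m 1 = N, monomial (m 0) (f.coeff m)
  have hmon : ∀ (c : k) (m : Fin 2 →₀ ℕ) (a : k), shear c (MvPolynomial.monomial m a) =
      C (C a) * ((C X - C (C c) * X) ^ m 0 * X ^ m 1) := by
    intro c m a
    rw [MvPolynomial.monomial_eq, Finsupp.prod_fintype _ _ (fun _ => pow_zero _), Fin.prod_univ_two]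
    simp [shear, ← MvPolynomial.algebraMap_eq, IsScalarTower.algebraMap_apply k k[X] k[X][X]]
  have hlin : ∀ c : k, (C X - C (C c) * X : k[X][X]).natDegree ≤ 1 := by
    intro c
    compute_degree
  have hdeg : ∀ (c : k) (m : Fin 2 →₀ ℕ) (a : k),
      (shear c (MvPolynomial.monomial m a)).natDegree ≤ m 0 + m 1 := by
    intro c m a
    rw [hmon]
    refine (natDegree_C_mul_le _ _).trans (natDegree_mul_le_of_le ?_ (natDegree_X_pow_le _))
    simpa using natDegree_pow_le_of_le (m 0) (hlin c)
  have hcoeff : ∀ (c : k) (m : Fin 2 →₀ ℕ) (a : k),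
      (shear c (MvPolynomial.monomial m a)).coeff (m 0 + m 1) = C (a * (-c) ^ m 0) := by
    intro c m a
    rw [hmon, coeff_C_mul, coeff_mul_X_pow]
    have := coeff_pow_of_natDegree_le (m := m 0) (hlin c)
    rw [mul_one] at this
    rw [this]
    simp
  have hle : ∀ m ∈ f.support, m 0 + m 1 ≤ N := by
    intro m hm
    have := MvPolynomial.le_totalDegree hm
    rwa [Finsupp.sum_fintype _ _ (fun _ => rfl), Fin.sum_univ_two] at this
  have hsum : ∀ c : k, shear c f = ∑ m ∈ f.support, shear c (MvPolynomial.monomial m (f.coeff m)) := by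
    intro c
    conv_lhs => rw [← f.support_sum_monomial_coeff]
    rw [map_sum]
  have hq : q ≠ 0 := by
    obtain ⟨m, hm, hmN⟩ : ∃ m ∈ f.support, m 0 + m 1 = N := by
      obtain ⟨m, hm, h⟩ := Finset.exists_mem_eq_sup f.support
        (MvPolynomial.support_nonempty.2 hf) (fun s => s.sum fun _ e => e)
      refine ⟨m, hm, ?_⟩
      rw [Finsupp.sum_fintype _ _ (fun _ => rfl), Fin.sum_univ_two] at h
      exact h.symm
    intro h0
    have h1 : q.coeff (m 0) = f.coeff m := by
      rw [finsetSum_coeff, Finset.sum_eq_single m]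
      · simp
      · intro m' hm' hne
        rw [coeff_monomial, if_neg]
        intro h
        refine hne (Finsupp.ext fun i => ?_)
        have := (Finset.mem_filter.1 hm').2
        fin_cases i
        · exact h
        · change m' 1 = m 1
          omega
      · intro h
        exact absurd (Finset.mem_filter.2 ⟨hm, hmN⟩) h
    rw [h0, coeff_zero] at h1
    exact MvPolynomial.mem_support_iff.1 hm h1.symm
  obtain ⟨c, hc⟩ : ∃ c : k, q.eval (-c) ≠ 0 := by
    by_contra! h
    refine hq (Polynomial.funext fun x => ?_)
    simpa using h (-x)
  refine ⟨c, q.eval (-c), hc, ?_, ?_⟩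
  · rw [hsum]
    exact natDegree_sum_le_of_forall_le _ _ fun m hm => (hdeg c m _).trans (hle m hm)
  · rw [hsum, finsetSum_coeff, eval_finsetSum, map_sum, Finset.sum_filter]
    refine Finset.sum_congr rfl fun m hm => ?_
    split_ifs with h
    · rw [← h, hcoeff, eval_monomial]
    · exact coeff_eq_zero_of_natDegree_lt
        ((hdeg c m _).trans_lt (lt_of_le_of_ne (hle m hm) h))

end Shear

end PlaneCurve

end Coordinates

/-! ### The coordinate ring over `k[X + cY]`, and the jacobian as a derivation. -/

section CurveJacobian

open Polynomial KaehlerDifferential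

namespace PlaneCurve

section ShearAlgebra

variable {k : Type*} [Field k] (f : MvPolynomial (Fin 2) k) (c : k)

/-- The structure of a `k[X]`-algebra on the coordinate ring for which `X` acts as the
function `X + c Y` on the curve. -/
noncomputable abbrev shearAlgebra : Algebra k[X] (CoordRing f) :=
  ((toCoordRing f).comp ((unshear c).comp C)).toAlgebra

theorem shearAlgebra_algebraMap_apply (p : k[X]) :
    (shearAlgebra f c).algebraMap p = toCoordRing f (unshear c (C p)) := rfl

theorem shearAlgebra_isScalarTower :
    letI := shearAlgebra f c
    IsScalarTower k k[X] (CoordRing f) :=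
  letI := shearAlgebra f c
  IsScalarTower.of_algebraMap_eq fun a => by
    rw [shearAlgebra_algebraMap_apply, unshear_C, algebraMap_eq, aeval_C]
    rfl

theorem shearAlgebra_aeval (g : k[X][X]) :
    letI := shearAlgebra f c
    aeval (toCoordRing f (MvPolynomial.X 1)) g = toCoordRing f (unshear c g) := by
  let := shearAlgebra f c
  have : ((aeval (toCoordRing f (MvPolynomial.X 1)) : k[X][X] →ₐ[k[X]] CoordRing f) :
      k[X][X] →+* CoordRing f) = (toCoordRing f).comp (unshear c) := by
    refine Polynomial.ringHom_ext (fun p => ?_) ?_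
    · simp [shearAlgebra_algebraMap_apply]
    · simp [unshear_X]
  exact congrArg (fun φ => φ g) this

theorem toCoordRing_surjective : Function.Surjective (toCoordRing f) :=
  Ideal.Quotient.mk_surjective

variable {f} in
theorem toCoordRing_eq_zero_iff {h : MvPolynomial (Fin 2) k} : toCoordRing f h = 0 ↔ f ∣ h :=
  Ideal.Quotient.eq_zero_iff_dvd f h

theorem shearAlgebra_adjoin_eq_top :
    letI := shearAlgebra f c
    Algebra.adjoin k[X] {toCoordRing f (MvPolynomial.X 1)} = ⊤ := by
  let := shearAlgebra f c
  rw [eq_top_iff]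
  rintro x -
  obtain ⟨h, rfl⟩ := toCoordRing_surjective f x
  rw [← unshear_shear c h, ← shearAlgebra_aeval]
  exact aeval_mem_adjoin_singleton _ _

variable {f c}

theorem shearAlgebra_isIntegral {r : k} (hr : r ≠ 0)
    (hdeg : (shear c f).natDegree ≤ f.totalDegree)
    (hcoeff : (shear c f).coeff f.totalDegree = C r) :
    letI := shearAlgebra f c
    IsIntegral k[X] (toCoordRing f (MvPolynomial.X 1)) := by
  let := shearAlgebra f c
  refine ⟨C (C r⁻¹) * shear c f, monic_of_natDegree_le_of_coeff_eq_one f.totalDegree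
    ((natDegree_C_mul_le _ _).trans hdeg) ?_, ?_⟩
  · rw [coeff_C_mul, hcoeff, ← C_mul, inv_mul_cancel₀ hr, C_1]
  · rw [← aeval_def, map_mul, shearAlgebra_aeval f c (shear c f), unshear_shear,
      toCoordRing_eq_zero_iff.2 dvd_rfl, mul_zero]

/-- A nonzero `p` in the kernel would be a multiple of the sheared `f`, forcing degree `0` in `Y`.
The unit coefficient then makes `f` a unit. -/
theorem shearAlgebra_injective (hf : Irreducible f) {r : k} (hr : r ≠ 0)
    (hcoeff : (shear c f).coeff f.totalDegree = C r) :
    Function.Injective (shearAlgebra f c).algebraMap := by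
  rw [injective_iff_map_eq_zero]
  intro p hp
  rw [shearAlgebra_algebraMap_apply, toCoordRing_eq_zero_iff, ← unshear_shear c f,
    unshear_dvd_unshear] at hp
  by_contra hp0
  have h1 := natDegree_le_of_dvd hp (C_ne_zero.2 hp0)
  rw [natDegree_C, nonpos_iff_eq_zero] at h1
  have h2 : f.totalDegree ≤ (shear c f).natDegree :=
    le_natDegree_of_ne_zero (by rw [hcoeff]; exact C_ne_zero.2 hr)
  rw [h1, nonpos_iff_eq_zero] at h2
  rw [h2] at hcoeff
  have h3 : IsUnit (shear c f) := by
    rw [eq_C_of_natDegree_eq_zero h1, hcoeff]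
    exact isUnit_C.2 (isUnit_C.2 hr.isUnit)
  exact hf.not_isUnit (unshear_shear c f ▸ h3.map (unshear c))

instance [hf : Fact (Irreducible f)] : IsDomain (CoordRing f) :=
  (Ideal.Quotient.isDomain_iff_prime _).2
    ((Ideal.span_singleton_prime hf.out.ne_zero).2 hf.out.prime)

/-- The minimal polynomial `F` and the sheared `f` divide each other, so the latter is `F g` with
`g` a unit; its derivative at `y` is `g(y) F'(y)`. -/
theorem shearAlgebra_jacobian [hf : Fact (Irreducible f)]
    (hint : letI := shearAlgebra f c; IsIntegral k[X] (toCoordRing f (MvPolynomial.X 1)))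
    (htf : letI := shearAlgebra f c; Module.IsTorsionFree k[X] (CoordRing f)) :
    letI := shearAlgebra f c
    ∃ v : (CoordRing f)ˣ, toCoordRing f (jacobian f (shearCoord c)) =
      v * aeval (toCoordRing f (MvPolynomial.X 1))
        (derivative (minpoly k[X] (toCoordRing f (MvPolynomial.X 1)))) := by
  let := shearAlgebra f c
  set y := toCoordRing f (MvPolynomial.X 1)
  set F := minpoly k[X] y with hF
  have hF0 : aeval y F = 0 := minpoly.aeval _ _
  have hG0 : aeval y (shear c f) = 0 := by
    rw [shearAlgebra_aeval f c, unshear_shear, toCoordRing_eq_zero_iff.2 dvd_rfl]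
  obtain ⟨g, hg⟩ := (minpoly.isIntegrallyClosed_dvd_iff hint _).1 hG0
  have hdvd : shear c f ∣ F := by
    rw [shearAlgebra_aeval f c, toCoordRing_eq_zero_iff] at hF0
    rwa [← unshear_dvd_unshear (c := c), unshear_shear]
  obtain ⟨g', hg'⟩ := hdvd
  have hgunit : IsUnit g := by
    refine IsUnit.of_mul_eq_one g' (mul_left_cancel₀ (minpoly.ne_zero hint) ?_)
    rw [mul_one, ← mul_assoc, ← hg, ← hg']
  refine ⟨(hgunit.map (aeval y)).unit, ?_⟩
  have h1 : jacobian f (shearCoord c) = unshear c (derivative (shear c f)) := by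
    conv_lhs => rw [← unshear_shear c f]
    exact jacobian_unshear_shearCoord c _
  rw [h1, ← shearAlgebra_aeval f c, hg, derivative_mul, map_add, map_mul, map_mul, hF0, zero_mul,
    add_zero, mul_comm]
  rfl

end ShearAlgebra

section JacobianDerivation

variable {k : Type*} [Field k] (f : MvPolynomial (Fin 2) k) (K : Type*) [Field K]
  [Algebra (CoordRing f) K]

theorem value_mul (a b : MvPolynomial (Fin 2) k) : value f K (a * b) = value f K a * value f K b := by
  simp [value]

theorem value_add (a b : MvPolynomial (Fin 2) k) : value f K (a + b) = value f K a + value f K b := by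
  simp [value]

theorem value_one : value f K 1 = 1 := by
  simp [value]

theorem jacobian_C (a : k) : jacobian f (MvPolynomial.C a) = 0 := by
  simp [jacobian]

theorem jacobian_add (g h : MvPolynomial (Fin 2) k) :
    jacobian f (g + h) = jacobian f g + jacobian f h := by
  simp only [jacobian, map_add]
  ring

theorem value_C [Algebra k K] [IsScalarTower k (CoordRing f) K] (a : k) :
    value f K (MvPolynomial.C a) = algebraMap k K a :=
  (IsScalarTower.algebraMap_apply k (CoordRing f) K a).symm

theorem D_value [Algebra k K] [IsScalarTower k (CoordRing f) K] (g : MvPolynomial (Fin 2) k) :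
    D k K (value f K g) = value f K (MvPolynomial.pderiv 0 g) • D k K (value f K (MvPolynomial.X 0)) +
      value f K (MvPolynomial.pderiv 1 g) • D k K (value f K (MvPolynomial.X 1)) := by
  have h0 : value f K 0 = 0 := by simp [value]
  induction g using MvPolynomial.induction_on with
  | C a => simp [value_C, h0]
  | add p q hp hq =>
    simp only [value_add, map_add, hp, hq, add_smul]
    abel
  | mul_X p i hp =>
    simp only [value_mul, Derivation.leibniz, hp, smul_eq_mul, value_add, add_smul, mul_smul,
      smul_add, MvPolynomial.pderiv_X]
    fin_cases i
    · simp [h0, value_one]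
      module
    · simp [h0, value_one]
      module

variable [IsFractionRing (CoordRing f) K]

theorem funJacobian_value (g : MvPolynomial (Fin 2) k) :
    funJacobian f (value f K g) = value f K (jacobian f g) := by
  have h := funJacobian_eq f K g 1 (by rw [value_one]; exact one_ne_zero)
  have h1 : jacobian f 1 = 0 := jacobian_C f 1
  have h0 : value f K 0 = 0 := by simp [value]
  rw [h1, value_one, mul_zero, h0] at h
  simpa using h

variable [Algebra k K] [IsScalarTower k (CoordRing f) K]

/-- The jacobian `J_f` as a derivation of the function field. -/
noncomputable def jacobianDerivation : Derivation k K K :=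
  Derivation.mk'
    { toFun := funJacobian f
      map_add' := by
        intro u v
        obtain ⟨⟨g, h⟩, hh, rfl⟩ := exists_fraction f u
        obtain ⟨⟨g', h'⟩, hh', rfl⟩ := exists_fraction f v
        dsimp only at hh hh' ⊢
        have hne : value f K (h * h') ≠ 0 := by
          rw [value_mul]
          exact mul_ne_zero hh hh'
        have : value f K g / value f K h + value f K g' / value f K h' =
            value f K (g * h' + h * g') / value f K (h * h') := by
          rw [value_mul, value_add, value_mul, value_mul, div_add_div _ _ hh hh']
        rw [this, funJacobian_eq _ _ _ _ hne, funJacobian_eq _ _ _ _ hh,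
          funJacobian_eq _ _ _ _ hh']
        simp only [jacobian_mul, jacobian_add, value_mul, value_add]
        field_simp
        ring
      map_smul' := by
        intro a u
        obtain ⟨⟨g, h⟩, hh, rfl⟩ := exists_fraction f u
        dsimp only at hh ⊢
        have : a • (value f K g / value f K h) =
            value f K (MvPolynomial.C a * g) / value f K h := by
          rw [value_mul, value_C, Algebra.smul_def, mul_div_assoc]
        rw [this, funJacobian_eq _ _ _ _ hh, funJacobian_eq _ _ _ _ hh, RingHom.id_apply,
          Algebra.smul_def]
        simp only [jacobian_mul, jacobian_C, value_mul, value_add, value_C, mul_zero]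
        have h0 : value f K 0 = 0 := by simp [value]
        rw [h0]
        ring }
    (by
      intro u v
      obtain ⟨⟨g, h⟩, hh, rfl⟩ := exists_fraction f u
      obtain ⟨⟨g', h'⟩, hh', rfl⟩ := exists_fraction f v
      dsimp only at hh hh' ⊢
      have hne : value f K (h * h') ≠ 0 := by
        rw [value_mul]
        exact mul_ne_zero hh hh'
      have : value f K g / value f K h * (value f K g' / value f K h') =
          value f K (g * g') / value f K (h * h') := by
        rw [value_mul, value_mul, div_mul_div_comm]
      change funJacobian f (_ * _) = _ * funJacobian f _ + _ * funJacobian f _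
      rw [this, funJacobian_eq _ _ _ _ hne, funJacobian_eq _ _ _ _ hh,
        funJacobian_eq _ _ _ _ hh']
      simp only [jacobian_mul, value_mul, value_add]
      field_simp
      ring)

theorem jacobianDerivation_apply (u : K) : jacobianDerivation f K u = funJacobian f u := rfl

theorem span_D_value_eq_top : Submodule.span K {D k K (value f K (MvPolynomial.X 0)),
    D k K (value f K (MvPolynomial.X 1))} = ⊤ := by
  rw [eq_top_iff, ← KaehlerDifferential.span_range_derivation, Submodule.span_le]
  rintro _ ⟨u, rfl⟩
  have hmem : ∀ g, D k K (value f K g) ∈ Submodule.span K {D k K (value f K (MvPolynomial.X 0)),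
      D k K (value f K (MvPolynomial.X 1))} := by
    intro g
    exact Submodule.mem_span_pair.2 ⟨_, _, (D_value f K g).symm⟩
  obtain ⟨⟨g, h⟩, hh, rfl⟩ := exists_fraction f u
  rw [SetLike.mem_coe, Derivation.leibniz_div]
  exact Submodule.smul_mem _ _ (sub_mem (Submodule.smul_mem _ _ (hmem g))
    (Submodule.smul_mem _ _ (hmem h)))

/-- If `J_f` does not vanish, it identifies the differentials of the function field with the
function field. -/
theorem jacobianDerivation_lift_bijective (h : jacobianDerivation f K ≠ 0) :
    Function.Bijective (jacobianDerivation f K).liftKaehlerDifferential := by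
  set Λ := (jacobianDerivation f K).liftKaehlerDifferential
  have hΛD : ∀ u, Λ (D k K u) = funJacobian f u := fun u =>
    Derivation.liftKaehlerDifferential_comp_D _ u
  set p := value f K (MvPolynomial.pderiv 0 f) with hp
  set q := value f K (MvPolynomial.pderiv 1 f) with hq
  set dx := D k K (value f K (MvPolynomial.X 0))
  set dy := D k K (value f K (MvPolynomial.X 1))
  have h0 : value f K 0 = 0 := by simp [value]
  have hx : Λ dx = q := by
    rw [hΛD, funJacobian_value, jacobian, hq]
    simp [MvPolynomial.pderiv_X]
  have hy : Λ dy = -p := by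
    rw [hΛD, funJacobian_value, jacobian, hp]
    simp [MvPolynomial.pderiv_X, value]
  have hrel : p • dx + q • dy = 0 := by
    rw [← D_value]
    have : toCoordRing f f = 0 := toCoordRing_eq_zero_iff.2 dvd_rfl
    rw [value, this, map_zero, map_zero]
  have hpq : p ≠ 0 ∨ q ≠ 0 := by
    by_contra! hpq
    apply h
    have : Λ = 0 := by
      refine LinearMap.ext_on (span_D_value_eq_top f K) ?_
      rintro _ (rfl | rfl)
      · rw [hx, hpq.2]; rfl
      · rw [hy, hpq.1, neg_zero]; rfl
    ext u
    rw [jacobianDerivation_apply, ← hΛD, this]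
    rfl
  constructor
  · rw [injective_iff_map_eq_zero]
    intro η hη
    obtain ⟨a, b, rfl⟩ := Submodule.mem_span_pair.1
      ((span_D_value_eq_top f K).ge (Submodule.mem_top (x := η)))
    rw [map_add, map_smul, map_smul, hx, hy, smul_eq_mul, smul_eq_mul] at hη
    -- Vanishing of `Λ` on `a dx + b dy` means `a q = b p`, which makes `p` or `q` times the form a
    -- multiple of `f_X dx + f_Y dy = 0`.
    rcases hpq with hp0 | hq0
    · refine (smul_eq_zero_iff_right hp0).1 ?_
      have hb : p * b = a * q := by linear_combination -hη
      change p • (a • dx + b • dy) = 0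
      rw [smul_add, smul_smul, smul_smul, hb, mul_comm, mul_smul, mul_smul, ← smul_add, hrel,
        smul_zero]
    · refine (smul_eq_zero_iff_right hq0).1 ?_
      have ha : q * a = b * p := by linear_combination hη
      change q • (a • dx + b • dy) = 0
      rw [smul_add, smul_smul, smul_smul, ha, mul_comm q, mul_smul, mul_smul, ← smul_add, hrel,
        smul_zero]
  · refine LinearMap.surjective fun hΛ => hpq.elim (fun hp0 => hp0 ?_) fun hq0 => hq0 ?_
    · rw [← neg_eq_zero, ← hy, hΛ]; rfl
    · rw [← hx, hΛ]; rfl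

end JacobianDerivation

end PlaneCurve

end CurveJacobian

/-! ### Comparison of lengths and the main theorem. -/

theorem Submodule.length_quotient_eq_add {R M : Type*} [Ring R] [AddCommGroup M] [Module R M]
    {N P : Submodule R M} (h : N ≤ P) : Module.length R (M ⧸ N) =
      Module.length R (M ⧸ P) + Module.length R (P ⧸ N.submoduleOf P) := by
  rw [add_comm]
  have hle : N.submoduleOf P ≤ LinearMap.ker (N.mkQ ∘ₗ P.subtype) := fun x hx =>
    (Submodule.Quotient.mk_eq_zero N).2 hx
  have hker : LinearMap.ker (N.mkQ ∘ₗ P.subtype) ≤ N.submoduleOf P := fun x hx =>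
    (Submodule.Quotient.mk_eq_zero N).1 hx
  refine Module.length_eq_add_of_exact ((N.submoduleOf P).liftQ (N.mkQ ∘ₗ P.subtype) hle)
    (Submodule.factor h) ?_ (Submodule.factor_surjective h) ?_
  · rw [← LinearMap.ker_eq_bot]
    exact Submodule.ker_liftQ_eq_bot _ _ _ hker
  · rw [LinearMap.exact_iff, Submodule.range_liftQ, LinearMap.range_comp, Submodule.range_subtype]
    ext x
    obtain ⟨x, rfl⟩ := N.mkQ_surjective x
    constructor
    · intro hx
      exact ⟨x, (Submodule.Quotient.mk_eq_zero P).1 hx, rfl⟩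
    · rintro ⟨y, hy, hxy⟩
      rw [← hxy]
      exact (Submodule.Quotient.mk_eq_zero P).2 hy

namespace PlaneCurve

open KaehlerDifferential

theorem map_jacobianIdealBar {k : Type*} [Field k] (f : MvPolynomial (Fin 2) k) (K : Type*) [Field K]
    [Algebra (CoordRing f) K] [IsFractionRing (CoordRing f) K] :
    Submodule.map (Algebra.linearMap (CoordRing f) K) (jacobianIdealBar f) =
    Submodule.span (CoordRing f)
      (Set.range fun s : CoordRing f => funJacobian f (algebraMap (CoordRing f) K s)) := by
  rw [jacobianIdealBar, jacobianIdeal, Ideal.map_span, Ideal.span, Submodule.map_span,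
    ← Set.range_comp, ← Set.range_comp, ← (toCoordRing_surjective f).range_comp]
  congr 2
  ext h
  exact (funJacobian_value f K h).symm

section Differentials

variable {k : Type*} [Field k] (f : MvPolynomial (Fin 2) k) (K : Type*) [Field K]
  [Algebra (CoordRing f) K] [IsFractionRing (CoordRing f) K] [Algebra k K]
  [IsScalarTower k (CoordRing f) K]

/-- The lift is injective and sends both `ω` and `du / J_f(u)` to `1`. -/
theorem isFundamentalDifferential_of_lift_eq_one (h : jacobianDerivation f K ≠ 0) {ω : Ω[K⁄k]}
    (hω : (jacobianDerivation f K).liftKaehlerDifferential ω = 1) :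
    IsFundamentalDifferential f ω := by
  have hbij := jacobianDerivation_lift_bijective f K h
  have hΛD : ∀ u, (jacobianDerivation f K).liftKaehlerDifferential (D k K u) = funJacobian f u :=
    fun u => Derivation.liftKaehlerDifferential_comp_D _ u
  have hne : ∀ u, D k K u ≠ 0 → funJacobian f u ≠ 0 := by
    intro u hu h0
    exact hu (hbij.1 ((hΛD u).trans (h0.trans (map_zero _).symm)))
  refine ⟨?_, fun u hu => ⟨hne u hu, hbij.1 ?_⟩⟩
  · by_contra! h0
    apply h
    ext u
    rw [jacobianDerivation_apply, ← hΛD, h0, map_zero]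
    rfl
  · rw [hω, map_smul, hΛD, smul_eq_mul, inv_mul_cancel₀ (hne u hu)]

/-- The map `Ω(S, k) → K`, `du ↦ J_f(u)`, for a ring `S` of functions. -/
noncomputable def differentialsToField (S : Type*) [CommRing S] [Algebra k S] [Algebra S K]
    [IsScalarTower k S K] : Ω[S⁄k] →ₗ[S] K :=
  (jacobianDerivation f K).liftKaehlerDifferential.restrictScalars S ∘ₗ
    KaehlerDifferential.map k k S K

theorem differentialsToField_D (S : Type*) [CommRing S] [Algebra k S] [Algebra S K]
    [IsScalarTower k S K] (s : S) :
    differentialsToField f K S (D k S s) = funJacobian f (algebraMap S K s) := by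
  refine (congrArg (jacobianDerivation f K).liftKaehlerDifferential
    (KaehlerDifferential.map_D k k S K s)).trans ?_
  exact Derivation.liftKaehlerDifferential_comp_D _ _

theorem range_differentialsToField (S : Type*) [CommRing S] [Algebra k S] [Algebra S K]
    [IsScalarTower k S K] : LinearMap.range (differentialsToField f K S) =
      Submodule.span S (Set.range fun s : S => funJacobian f (algebraMap S K s)) := by
  rw [LinearMap.range_eq_map, ← KaehlerDifferential.span_range_derivation, Submodule.map_span,
    ← Set.range_comp]
  congr 2
  ext s
  exact differentialsToField_D f K S s

/-- In `K`, the ideal `J̄_f` is the image of `Ω(R, k)`, and that map factors through `Ω(R̄, k)`;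
injectivity pulls membership back. -/
theorem differentialsToField_mem_map_jacobianIdealBar
    (hinj : Function.Injective (differentialsToField f K (Normalization f K)))
    (τ : Ω[Normalization f K⁄k]) : differentialsToField f K (Normalization f K) τ ∈
      Submodule.map (Algebra.linearMap (CoordRing f) K) (jacobianIdealBar f) ↔ τ ∈ differentialsImage f K := by
  have hcomp : ((differentialsToField f K (Normalization f K)).restrictScalars (CoordRing f)) ∘ₗ
      KaehlerDifferential.map k k (CoordRing f) (Normalization f K) =
      differentialsToField f K (CoordRing f) := by
    refine LinearMap.ext_on (KaehlerDifferential.span_range_derivation k (CoordRing f)) ?_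
    rintro _ ⟨s, rfl⟩
    rw [LinearMap.comp_apply, KaehlerDifferential.map_D, differentialsToField_D,
      LinearMap.restrictScalars_apply, differentialsToField_D, ← IsScalarTower.algebraMap_apply]
  rw [map_jacobianIdealBar, ← range_differentialsToField, ← hcomp, LinearMap.range_comp]
  constructor
  · rintro ⟨τ', hτ', h⟩
    exact hinj h ▸ hτ'
  · exact fun h => ⟨τ, h, rfl⟩

theorem length_quotient_extJacobianIdeal : Module.length (MvPolynomial (Fin 2) k)
      (MvPolynomial (Fin 2) k ⧸ extJacobianIdeal f) =
    Module.length (CoordRing f) (CoordRing f ⧸ jacobianIdealBar f) := by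
  let : Algebra (MvPolynomial (Fin 2) k) (CoordRing f) := (toCoordRing f).toAlgebra
  rw [← Module.length_eq_of_surjective (S := MvPolynomial (Fin 2) k) (R := CoordRing f)
    (toCoordRing_surjective f)]
  let φ : MvPolynomial (Fin 2) k →ₗ[MvPolynomial (Fin 2) k] CoordRing f ⧸ jacobianIdealBar f :=
    (jacobianIdealBar f).mkQ.restrictScalars _ ∘ₗ Algebra.linearMap _ _
  have hφ : Function.Surjective φ :=
    (Submodule.mkQ_surjective _).comp (toCoordRing_surjective f)
  have hker : LinearMap.ker φ = extJacobianIdeal f := by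
    have : LinearMap.ker φ = (jacobianIdealBar f).comap (toCoordRing f) := by
      ext h
      exact Submodule.Quotient.mk_eq_zero _
    rw [this, jacobianIdealBar, Ideal.comap_map_of_surjective _ (toCoordRing_surjective f),
      extJacobianIdeal, sup_comm]
    congr 1
    exact Ideal.mk_ker
  rw [← (φ.quotKerEquivOfSurjective hφ).length_eq, hker]

end Differentials

end PlaneCurve

open PlaneCurve KaehlerDifferential in
theorem proposition2p4 {k : Type*} [Field k] [IsAlgClosed k] [CharZero k]
    (f : MvPolynomial (Fin 2) k) (hf : Irreducible f)
    -- `K` is the function field of the curve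
    (K : Type*) [Field K] [Algebra (CoordRing f) K] [IsFractionRing (CoordRing f) K]
    [Algebra k K] [IsScalarTower k (CoordRing f) K] :
    -- the ideal generated by the jacobians of the elements of `R̄` is the conductor
    ((normJacobianIdeal f K : Set K) =
      algebraMap (CoordRing f) K '' (conductorIdeal f K : Set (CoordRing f))) ∧
    -- `Ω(R̄, k)` embeds in `Ω(K, k)` with image `𝔠 ω`
    (∃ ω : Ω[K⁄k], IsFundamentalDifferential f ω ∧
      Function.Injective (KaehlerDifferential.map k k (Normalization f K) K) ∧
      Set.range (KaehlerDifferential.map k k (Normalization f K) K) =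
        {η | ∃ c ∈ conductorIdeal f K, η = algebraMap (CoordRing f) K c • ω}) ∧
    jacobianIdealBar f ≤ conductorIdeal f K ∧
    -- the lengths are finite, and they satisfy the three equalities
    Module.length (MvPolynomial (Fin 2) k) (MvPolynomial (Fin 2) k ⧸ extJacobianIdeal f) ≠ ⊤ ∧
    Module.length (MvPolynomial (Fin 2) k) (MvPolynomial (Fin 2) k ⧸ extJacobianIdeal f) =
      Module.length (CoordRing f) (CoordRing f ⧸ jacobianIdealBar f) ∧
    Module.length (CoordRing f) (CoordRing f ⧸ jacobianIdealBar f) =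
      Module.length (CoordRing f) (CoordRing f ⧸ conductorIdeal f K) +
        Module.length (CoordRing f)
          (conductorIdeal f K ⧸ (jacobianIdealBar f).submoduleOf (conductorIdeal f K)) ∧
    Module.length (CoordRing f) (CoordRing f ⧸ conductorIdeal f K) +
        Module.length (CoordRing f)
          (conductorIdeal f K ⧸ (jacobianIdealBar f).submoduleOf (conductorIdeal f K)) =
      Module.length (CoordRing f)
          (Normalization f K ⧸
            LinearMap.range (Algebra.linearMap (CoordRing f) (Normalization f K))) +
        Module.length (CoordRing f)
          (Ω[Normalization f K⁄k] ⧸ differentialsImage f K) := by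
  have : Fact (Irreducible f) := ⟨hf⟩
  have hRK : Function.Injective (algebraMap (CoordRing f) K) := IsFractionRing.injective _ _
  obtain ⟨c, r, hr, hdeg, hcoeff⟩ := exists_coeff_shear_eq hf.ne_zero
  let : Algebra (Polynomial k) (CoordRing f) := shearAlgebra f c
  have : IsScalarTower k (Polynomial k) (CoordRing f) := shearAlgebra_isScalarTower f c
  have hadj := shearAlgebra_adjoin_eq_top f c
  have hint := shearAlgebra_isIntegral hr hdeg hcoeff
  have : Module.Finite (Polynomial k) (CoordRing f) := ⟨by
    have := hint.fg_adjoin_singleton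
    rwa [hadj, Algebra.top_toSubmodule] at this⟩
  have : FaithfulSMul (Polynomial k) (CoordRing f) :=
    (faithfulSMul_iff_algebraMap_injective _ _).2 (shearAlgebra_injective hf hr hcoeff)
  have : Module.IsTorsionFree (Polynomial k) (CoordRing f) := inferInstance
  let : Algebra (Polynomial k) K :=
    ((algebraMap (CoordRing f) K).comp (algebraMap (Polynomial k) (CoordRing f))).toAlgebra
  have : IsScalarTower (Polynomial k) (CoordRing f) K := IsScalarTower.of_algebraMap_eq fun _ => rfl
  obtain ⟨v, hv⟩ := shearAlgebra_jacobian hint inferInstance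
  have hX : algebraMap (CoordRing f) K (algebraMap (Polynomial k) (CoordRing f) Polynomial.X) =
      value f K (shearCoord c) := by
    rw [shearAlgebra_algebraMap_apply, unshear_C, Polynomial.aeval_X]
    rfl
  obtain ⟨h1, h2, h3, h4⟩ := MonogenicOrder.conductor_eq_and_length_eq hadj (jacobianDerivation f K)
    ⟨v, by rw [← hv, hX]; exact funJacobian_value f K _⟩ (𝔠 := conductorIdeal f K) fun _ => Iff.rfl
  have hJ : jacobianDerivation f K ≠ 0 := by
    intro h0
    rw [h0] at h2
    exact h2 rfl
  have hbij := jacobianDerivation_lift_bijective f K hJ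
  obtain ⟨ω, hω⟩ := hbij.2 1
  have hinj := h3 ⟨ω, 0, by rintro rfl; rw [map_zero] at hω; exact zero_ne_one hω⟩
  have hrange := range_differentialsToField f K (Normalization f K)
  have hinj' : Function.Injective (differentialsToField f K (Normalization f K)) :=
    hbij.1.comp hinj
  have hle : jacobianIdealBar f ≤ conductorIdeal f K := by
    intro x hx
    have hx' : algebraMap (CoordRing f) K x ∈
        Submodule.map (Algebra.linearMap (CoordRing f) K) (jacobianIdealBar f) := ⟨x, hx, rfl⟩
    rw [map_jacobianIdealBar] at hx'
    have hspan : Submodule.span (CoordRing f) (Set.range fun s : CoordRing f =>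
        funJacobian f (algebraMap (CoordRing f) K s)) ≤
        (normJacobianIdeal f K).restrictScalars (CoordRing f) := by
      refine Submodule.span_le.2 ?_
      rintro _ ⟨s, rfl⟩
      exact Submodule.subset_span ⟨algebraMap (CoordRing f) (Normalization f K) s, rfl⟩
    obtain ⟨y, hy, hxy⟩ := h1.le (hspan hx')
    exact hRK hxy ▸ hy
  -- `J_f(X + cY)` is a nonzero element of `J̄_f`, which gives finiteness of the lengths.
  have hbot : jacobianIdealBar f ≠ ⊥ := by
    intro h0
    have hmem : toCoordRing f (jacobian f (shearCoord c)) ∈ jacobianIdealBar f :=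
      Ideal.mem_map_of_mem _ (Ideal.subset_span ⟨_, rfl⟩)
    rw [h0, Ideal.mem_bot] at hmem
    apply h2
    rw [hX]
    refine (funJacobian_value f K _).trans ?_
    rw [value, hmem, map_zero]
  refine ⟨h1, ⟨ω, isFundamentalDifferential_of_lift_eq_one f K hJ hω, hinj, ?_⟩, hle, ?_,
    length_quotient_extJacobianIdeal f, Submodule.length_quotient_eq_add hle, ?_⟩
  · ext η
    have hη : η ∈ Set.range (KaehlerDifferential.map k k (Normalization f K) K) ↔
        (jacobianDerivation f K).liftKaehlerDifferential η ∈
          (LinearMap.range (differentialsToField f K (Normalization f K)) : Set K) :=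
      exists_congr fun τ => hbij.1.eq_iff.symm
    rw [hη, (congrArg SetLike.coe hrange).trans h1]
    refine exists_congr fun c => and_congr_right fun _ => ?_
    rw [← hbij.1.eq_iff, map_smul, hω, smul_eq_mul, mul_one, eq_comm]
  · rw [length_quotient_extJacobianIdeal]
    exact Ideal.length_quotient_ne_top_of_ne_bot k hbot
  · rw [h4]
    congr 1
    -- Both remaining quotients are identified with the quotient of the images of `𝔠` and `J̄_f` in
    -- `K`.
    obtain ⟨e₁⟩ := Submodule.nonempty_quotient_submoduleOf_equiv
      (P := Submodule.map (Algebra.linearMap (CoordRing f) K) (conductorIdeal f K))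
      (Q := Submodule.map (Algebra.linearMap (CoordRing f) K) (jacobianIdealBar f))
      (U := (jacobianIdealBar f).submoduleOf (conductorIdeal f K))
      (Algebra.linearMap (CoordRing f) K ∘ₗ (conductorIdeal f K).subtype) (by
        rw [LinearMap.range_comp, Submodule.range_subtype]) (by
        rintro ⟨x, hx⟩
        refine ⟨fun ⟨y, hy, hxy⟩ => ?_, fun h => ⟨x, h, rfl⟩⟩
        obtain rfl : y = x := hRK hxy
        exact hy)
    obtain ⟨e₂⟩ := Submodule.nonempty_quotient_submoduleOf_equiv
      (P := Submodule.map (Algebra.linearMap (CoordRing f) K) (conductorIdeal f K))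
      (Q := Submodule.map (Algebra.linearMap (CoordRing f) K) (jacobianIdealBar f))
      (U := differentialsImage f K)
      ((differentialsToField f K (Normalization f K)).restrictScalars (CoordRing f)) (by
        refine SetLike.coe_injective ?_
        exact (congrArg SetLike.coe hrange).trans h1)
      (differentialsToField_mem_map_jacobianIdealBar f K hinj')
    rw [← e₁.length_eq, ← e₂.length_eq]
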